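/- **Conventions.** 2-categories, 2-functors are strict; the naturality constraints of a pseudonatural transformation are invertible; $g.f$ denotes "$f$ followed by $g$". A *pseudomonad* $(\mathcal A,S)$ consists of a 2-category $\mathcal A$, a 2-functor $S:\mathcal A\to\mathcal A$, pseudonatural transformations $\eta:1_{\mathcal A}\Rightarrow S$ and $\mu:S^2\Rightarrow S$, and invertible modifications $\lambda:1_S\Rrightarrow \mu.\eta_S$, $\rho:\mu.S\eta\Rrightarrow 1_S$, $\alpha:\mu.S\mu\Rrightarrow\mu.\mu_S$, such that $$\mu \xrightarrow{\ \mu.S\lambda\ } \mu.S\mu.S\eta_S \xrightarrow{\ \alpha.S\eta_S\ } \mu.\mu_S.S\eta_S \xrightarrow{\ \mu.\rho_S\ } \mu$$ is the identity, and the two modifications $\mu.S\mu.S^2\mu\Rrightarrow\mu.\mu_S.\mu_{S^2}$ given by $$(\mu.\alpha_S)\circ(\alpha.S\mu_S)\circ(\mu.S\alpha)\quad\text{and}\quad(\alpha.\mu_{S^2})\circ(\mu.\mu_\mu)\circ(\alpha.S^2\mu)$$ are equal, where $\mu_f:\mu_Y.S^2f\Rightarrow Sf.\mu_X$ is the constraint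 of $\mu$ at $f:X\to Y$. A *pseudoadjunction* consists of 2-functors $\bar F:\mathcal A\to\mathcal B$ and $\bar U:\mathcal B\to\mathcal A$, pseudonatural transformations $\eta:1_{\mathcal A}\Rightarrow\bar U\bar F$ and $\bar\varepsilon:\bar F\bar U\Rightarrow 1_{\mathcal B}$, and invertible modifications $\bar u:1_{\bar F}\Rrightarrow\bar\varepsilon_{\bar F}.\bar F\eta$ and $\bar\lambda:1_{\bar U}\Rrightarrow\bar U\bar\varepsilon.\eta_{\bar U}$, satisfying the two swallowtail identities: for all $Y\in\mathcal B$ and $X\in\mathcal A$ the composites $$\bar\varepsilon_Y\xrightarrow{\ \bar\varepsilon_Y.\bar u_{\bar UY}\ }\bar\varepsilon_Y.\bar\varepsilon_{\bar F\bar UY}.\bar F\eta_{\bar UY}\xrightarrow{\ \bar\varepsilon_{\bar\varepsilon_Y}^{-1}.\bar F\eta_{\bar UY}\ }\bar\varepsilon_Y.\bar F\bar U\bar\varepsilon_Y.\bar F\eta_{\bar UY}\xrightarrow{\ \bar\varepsilon_Y.\bar F\bar\lambda_Y^{-1}\ }\bar\varepsilon_Y,$$ $$\eta_X\xrightarrow{\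 \bar\lambda_{\bar FX}.\eta_X\ }\bar U\bar\varepsilon_{\bar FX}.\eta_{\bar U\bar FX}.\eta_X\xrightarrow{\ \bar U\bar\varepsilon_{\bar FX}.\eta_{\eta_X}\ }\bar U\bar\varepsilon_{\bar FX}.\bar U\bar F\eta_X.\eta_X\xrightarrow{\ \bar U\bar u_X^{-1}.\eta_X\ }\eta_X$$ are identities (here $\bar\varepsilon_{\bar\varepsilon_Y}$ and $\eta_{\eta_X}:\eta_{\bar U\bar FX}.\eta_X\Rightarrow\bar U\bar F\eta_X.\eta_X$ are naturality constraints). Its *induced pseudomonad* on $\mathcal A$ has $S=\bar U\bar F$, unit $\eta$, $\mu=\bar U\bar\varepsilon_{\bar F}$, $\lambda=\bar\lambda_{\bar F}$, $\rho=(\bar U\bar u)^{-1}$ and $\alpha_X=\bar U(\bar\varepsilon_{\bar\varepsilon_{\bar FX}})$, where $\bar\varepsilon_g:\bar\varepsilon_Z.\bar F\bar Ug\Rightarrow g.\bar\varepsilon_Y$ is the constraint of $\bar\varepsilon$ at $g:Y\to Z$. The pseudoadjunction *splits* $(\mathcal A,S)$ if its induced pseudomonad is $(\mathcal A,S)$.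 The *$\mathbf{Gray}$-enriched Kleisli object* $\mathcal A_S$ of $(\mathcal A,S)$ is the 2-category presented as follows. It has the objects of $\mathcal A$, all 1-cells and 2-cells of $\mathcal A$ as generators subject to all relations (identities, composition, whiskering) that hold in $\mathcal A$, a further generating 1-cell $\varepsilon_X:SX\to X$ for each object $X$, and further generating invertible 2-cells $$\varepsilon_f:\varepsilon_Y.Sf\Rightarrow f.\varepsilon_X\ (f:X\to Y \text{ in }\mathcal A),\qquad u_X:1_X\Rightarrow\varepsilon_X.\eta_X,\qquad m_X:\varepsilon_X.\varepsilon_{SX}\Rightarrow\varepsilon_X.\mu_X .$$ The relations on these say that $(\varepsilon_X,\varepsilon_f)$ is pseudonatural in $X$, $f$ and 2-cells of $\mathcal A$; that $u$ and $m$ are modifications; that the composite $$\varepsilon_X\xrightarrow{\ \varepsilon_X.u_{SX}\ }\varepsilon_X.\varepsilon_{SX}.\eta_{SX}\xrightarrow{\ m_X.\eta_{SX}\ }\varepsilon_X.\mu_X.\eta_{SX}\xrightarrow{\ \varepsilon_X.\lambda_X^{-1}\ }\varepsilon_X$$ is the identity; and that the two 2-cells $\varepsilon_X.\varepsilon_{SX}.\varepsilon_{S^2X}\Rightarrow\varepsilon_X.\mu_X.S\mu_X$,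 namely $$(\varepsilon_X.\alpha_X^{-1})\circ(m_X.\mu_{SX})\circ(\varepsilon_X.m_{SX})\quad\text{and}\quad(m_X.S\mu_X)\circ(\varepsilon_X.\varepsilon_{\mu_X}^{-1})\circ(m_X.\varepsilon_{S^2X}),$$ are equal. For a pseudoadjunction $(\bar F,\bar U,\eta,\bar\varepsilon,\bar\lambda,\bar u)$ splitting $(\mathcal A,S)$, the *canonical comparison 2-functor* $K:\mathcal A_S\to\mathcal B$ is the 2-functor that sends all data from $\mathcal A$ to its image under $\bar F$, and $$\varepsilon_X\mapsto\bar\varepsilon_{\bar FX},\qquad \varepsilon_f\mapsto\bar\varepsilon_{\bar Ff},\qquad u_X\mapsto\bar u_X,\qquad m_X\mapsto(\bar\varepsilon_{\bar\varepsilon_{\bar FX}})^{-1}.$$ **Theorem.** For every pseudomonad $(\mathcal A,S)$ and every pseudoadjunction splitting it, the canonical comparison 2-functor $K:\mathcal A_S\to\mathcal B$ is bi-fully faithful: for all objects $X,Y$ of $\mathcal A_S$, the functor $K_{X,Y}:\mathcal A_S(X,Y)\to\mathcal B(KX,KY)$ is an equivalence of categories. -/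

import Mathlib

open CategoryTheory Bicategory

universe w v u w' v' u'

/-- A 2-category is a strict bicategory, a 2-functor is a `StrictPseudofunctor`, a pseudonatural
transformation is a `StrongTrans`; `f ≫ g` is `f` followed by `g`.

The 1- and 2-dimensional data of a pseudomonad on a 2-category `A`: a 2-functor `S` and
pseudonatural transformations `unit : 1 ⟶ S`, `mult : S S ⟶ S`. -/
structure PseudomonadData (A : Type u) [Bicategory.{w, v} A] [Strict A] where
  S : StrictPseudofunctor A A
  unit : Pseudofunctor.StrongTrans (Pseudofunctor.id A) S.toPseudofunctor
  mult : Pseudofunctor.StrongTrans (S.toPseudofunctor.comp S.toPseudofunctor) S.toPseudofunctor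

namespace PseudomonadData

variable {A : Type u} [Bicategory.{w, v} A] [Strict A] (D : PseudomonadData A)

def unitApp (X : A) : X ⟶ D.S.obj X := D.unit.app X

def unitNat {X Y : A} (f : X ⟶ Y) : f ≫ D.unitApp Y ≅ D.unitApp X ≫ D.S.map f :=
  D.unit.naturality f

def multApp (X : A) : D.S.obj (D.S.obj X) ⟶ D.S.obj X := D.mult.app X

def multNat {X Y : A} (f : X ⟶ Y) :
    D.S.map (D.S.map f) ≫ D.multApp Y ≅ D.multApp X ≫ D.S.map f :=
  D.mult.naturality f

end PseudomonadData

/-- A pseudomonad `(A, S)` whose underlying endomorphism is a 2-functor. The invertible modifications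
`lam : 1 ≅ μ ∘ η_S`, `rho : μ ∘ S η ≅ 1`, `alpha : μ ∘ S μ ≅ μ ∘ μ_S` are given by their components
(the fields `…_naturality` are the modification axioms), and satisfy the two coherence axioms. -/
structure Pseudomonad (A : Type u) [Bicategory.{w, v} A] [Strict A]
    extends D : PseudomonadData A where
  lam (X : A) : 𝟙 (D.S.obj X) ≅ D.unitApp (D.S.obj X) ≫ D.multApp X
  rho (X : A) : D.S.map (D.unitApp X) ≫ D.multApp X ≅ 𝟙 (D.S.obj X)
  alpha (X : A) : D.S.map (D.multApp X) ≫ D.multApp X ≅ D.multApp (D.S.obj X) ≫ D.multApp X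
  lam_naturality {X Y : A} (f : X ⟶ Y) :
    D.S.map f ◁ (lam Y).hom ≫ (α_ _ _ _).inv ≫ (D.unitNat (D.S.map f)).hom ▷ D.multApp Y ≫
        (α_ _ _ _).hom ≫ D.unitApp (D.S.obj X) ◁ (D.multNat f).hom =
      (ρ_ _).hom ≫ (λ_ _).inv ≫ (lam X).hom ▷ D.S.map f ≫ (α_ _ _ _).hom
  rho_naturality {X Y : A} (f : X ⟶ Y) :
    D.S.map f ◁ (rho Y).hom ≫ (ρ_ _).hom ≫ (λ_ _).inv =
      (α_ _ _ _).inv ≫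
        ((D.S.mapComp _ _).inv ≫ D.S.map₂ (D.unitNat f).hom ≫ (D.S.mapComp _ _).hom) ▷ D.multApp Y ≫
        (α_ _ _ _).hom ≫ D.S.map (D.unitApp X) ◁ (D.multNat f).hom ≫ (α_ _ _ _).inv ≫
        (rho X).hom ▷ D.S.map f
  alpha_naturality {X Y : A} (f : X ⟶ Y) :
    D.S.map (D.S.map (D.S.map f)) ◁ (alpha Y).hom ≫ (α_ _ _ _).inv ≫
        (D.multNat (D.S.map f)).hom ▷ D.multApp Y ≫ (α_ _ _ _).hom ≫
        D.multApp (D.S.obj X) ◁ (D.multNat f).hom ≫ (α_ _ _ _).inv =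
      (α_ _ _ _).inv ≫
        ((D.S.mapComp _ _).inv ≫ D.S.map₂ (D.multNat f).hom ≫ (D.S.mapComp _ _).hom) ▷ D.multApp Y ≫
        (α_ _ _ _).hom ≫ D.S.map (D.multApp X) ◁ (D.multNat f).hom ≫ (α_ _ _ _).inv ≫
        (alpha X).hom ▷ D.S.map f
  unit_coherence (X : A) :
    (λ_ _).inv ≫
        ((D.S.mapId _).inv ≫ D.S.map₂ (lam X).hom ≫ (D.S.mapComp _ _).hom) ▷ D.multApp X ≫
        (α_ _ _ _).hom ≫ D.S.map (D.unitApp (D.S.obj X)) ◁ (alpha X).hom ≫ (α_ _ _ _).inv ≫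
        (rho (D.S.obj X)).hom ▷ D.multApp X ≫ (λ_ _).hom =
      𝟙 (D.multApp X)
  assoc_coherence (X : A) :
    (α_ _ _ _).inv ≫
        ((D.S.mapComp _ _).inv ≫ D.S.map₂ (alpha X).hom ≫ (D.S.mapComp _ _).hom) ▷ D.multApp X ≫
        (α_ _ _ _).hom ≫ D.S.map (D.multApp (D.S.obj X)) ◁ (alpha X).hom ≫ (α_ _ _ _).inv ≫
        (alpha (D.S.obj X)).hom ▷ D.multApp X ≫ (α_ _ _ _).hom =
      D.S.map (D.S.map (D.multApp X)) ◁ (alpha X).hom ≫ (α_ _ _ _).inv ≫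
        (D.multNat (D.multApp X)).hom ▷ D.multApp X ≫ (α_ _ _ _).hom ≫
        D.multApp (D.S.obj (D.S.obj X)) ◁ (alpha X).hom

/-- 2-functors `F : A ⟶ B`, `U : B ⟶ A` with pseudonatural transformations `unit : 1 ⟶ U F` and
`counit : F U ⟶ 1`. -/
structure PseudoadjunctionData (A : Type u) [Bicategory.{w, v} A] [Strict A]
    (B : Type u') [Bicategory.{w', v'} B] [Strict B] where
  F : StrictPseudofunctor A B
  U : StrictPseudofunctor B A
  unit : Pseudofunctor.StrongTrans (Pseudofunctor.id A) (F.toPseudofunctor.comp U.toPseudofunctor)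
  counit : Pseudofunctor.StrongTrans (U.toPseudofunctor.comp F.toPseudofunctor) (Pseudofunctor.id B)

namespace PseudoadjunctionData

variable {A : Type u} [Bicategory.{w, v} A] [Strict A]
  {B : Type u'} [Bicategory.{w', v'} B] [Strict B] (D : PseudoadjunctionData A B)

def unitApp (X : A) : X ⟶ D.U.obj (D.F.obj X) := D.unit.app X

def unitNat {X Y : A} (f : X ⟶ Y) :
    f ≫ D.unitApp Y ≅ D.unitApp X ≫ D.U.map (D.F.map f) :=
  D.unit.naturality f

def counitApp (Y : B) : D.F.obj (D.U.obj Y) ⟶ Y := D.counit.app Y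

def counitNat {Y Z : B} (g : Y ⟶ Z) :
    D.F.map (D.U.map g) ≫ D.counitApp Z ≅ D.counitApp Y ≫ g :=
  D.counit.naturality g

end PseudoadjunctionData

/-- A pseudoadjunction between 2-functors: the two triangle identities hold up to invertible
modifications `u`, `l` (given by components, with their modification axioms), and these satisfy the
two swallowtail identities. -/
structure Pseudoadjunction (A : Type u) [Bicategory.{w, v} A] [Strict A]
    (B : Type u') [Bicategory.{w', v'} B] [Strict B]
    extends D : PseudoadjunctionData A B where
  u (X : A) : 𝟙 (D.F.obj X) ≅ D.F.map (D.unitApp X) ≫ D.counitApp (D.F.obj X)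
  l (Y : B) : 𝟙 (D.U.obj Y) ≅ D.unitApp (D.U.obj Y) ≫ D.U.map (D.counitApp Y)
  u_naturality {X Y : A} (f : X ⟶ Y) :
    D.F.map f ◁ (u Y).hom ≫ (α_ _ _ _).inv ≫
        ((D.F.mapComp _ _).inv ≫ D.F.map₂ (D.unitNat f).hom ≫ (D.F.mapComp _ _).hom) ▷
          D.counitApp (D.F.obj Y) ≫
        (α_ _ _ _).hom ≫ D.F.map (D.unitApp X) ◁ (D.counitNat (D.F.map f)).hom =
      (ρ_ _).hom ≫ (λ_ _).inv ≫ (u X).hom ▷ D.F.map f ≫ (α_ _ _ _).hom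
  l_naturality {Y Z : B} (g : Y ⟶ Z) :
    D.U.map g ◁ (l Z).hom ≫ (α_ _ _ _).inv ≫ (D.unitNat (D.U.map g)).hom ▷ D.U.map (D.counitApp Z) ≫
        (α_ _ _ _).hom ≫ D.unitApp (D.U.obj Y) ◁
          ((D.U.mapComp _ _).inv ≫ D.U.map₂ (D.counitNat g).hom ≫ (D.U.mapComp _ _).hom) =
      (ρ_ _).hom ≫ (λ_ _).inv ≫ (l Y).hom ▷ D.U.map g ≫ (α_ _ _ _).hom
  swallowtail_counit (Y : B) :
    (λ_ _).inv ≫ (u (D.U.obj Y)).hom ▷ D.counitApp Y ≫ (α_ _ _ _).hom ≫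
        D.F.map (D.unitApp (D.U.obj Y)) ◁ (D.counitNat (D.counitApp Y)).inv ≫ (α_ _ _ _).inv ≫
        ((D.F.mapComp _ _).inv ≫ D.F.map₂ (l Y).inv ≫ (D.F.mapId _).hom) ▷ D.counitApp Y ≫ (λ_ _).hom =
      𝟙 (D.counitApp Y)
  swallowtail_unit (X : A) :
    (ρ_ _).inv ≫ D.unitApp X ◁ (l (D.F.obj X)).hom ≫ (α_ _ _ _).inv ≫
        (D.unitNat (D.unitApp X)).hom ▷ D.U.map (D.counitApp (D.F.obj X)) ≫ (α_ _ _ _).hom ≫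
        D.unitApp X ◁ ((D.U.mapComp _ _).inv ≫ D.U.map₂ (u X).inv ≫ (D.U.mapId _).hom) ≫ (ρ_ _).hom =
      𝟙 (D.unitApp X)

/-- A 2-functor `F : A ⟶ C` with a pseudonatural action `act : F S ⟶ F`. -/
structure KleisliCoconeData {A : Type u} [Bicategory.{w, v} A] [Strict A] (T : Pseudomonad A)
    (C : Type u') [Bicategory.{w', v'} C] [Strict C] where
  F : StrictPseudofunctor A C
  act : Pseudofunctor.StrongTrans (T.S.toPseudofunctor.comp F.toPseudofunctor) F.toPseudofunctor

namespace KleisliCoconeData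

variable {A : Type u} [Bicategory.{w, v} A] [Strict A] {T : Pseudomonad A}
  {C : Type u'} [Bicategory.{w', v'} C] [Strict C] (D : KleisliCoconeData T C)

def actApp (X : A) : D.F.obj (T.S.obj X) ⟶ D.F.obj X := D.act.app X

def actNat {X Y : A} (f : X ⟶ Y) :
    D.F.map (T.S.map f) ≫ D.actApp Y ≅ D.actApp X ≫ D.F.map f :=
  D.act.naturality f

end KleisliCoconeData

/-- A 2-functor `F : A ⟶ C` with the structure of a pseudoalgebra for precomposition with `(A, S)`:
a pseudonatural action `act : F S ⟶ F` with invertible modifications `u` and `m` satisfying the two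
pseudoalgebra axioms. These are the cocones under `(A, S)` of which `GrayKleisli T` is the
universal one. -/
structure KleisliCocone {A : Type u} [Bicategory.{w, v} A] [Strict A] (T : Pseudomonad A)
    (C : Type u') [Bicategory.{w', v'} C] [Strict C]
    extends D : KleisliCoconeData T C where
  u (X : A) : 𝟙 (D.F.obj X) ≅ D.F.map (T.unitApp X) ≫ D.actApp X
  m (X : A) : D.actApp (T.S.obj X) ≫ D.actApp X ≅ D.F.map (T.multApp X) ≫ D.actApp X
  u_naturality {X Y : A} (f : X ⟶ Y) :
    D.F.map f ◁ (u Y).hom ≫ (α_ _ _ _).inv ≫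
        ((D.F.mapComp _ _).inv ≫ D.F.map₂ (T.unitNat f).hom ≫ (D.F.mapComp _ _).hom) ▷ D.actApp Y ≫
        (α_ _ _ _).hom ≫ D.F.map (T.unitApp X) ◁ (D.actNat f).hom =
      (ρ_ _).hom ≫ (λ_ _).inv ≫ (u X).hom ▷ D.F.map f ≫ (α_ _ _ _).hom
  m_naturality {X Y : A} (f : X ⟶ Y) :
    D.F.map (T.S.map (T.S.map f)) ◁ (m Y).hom ≫ (α_ _ _ _).inv ≫
        ((D.F.mapComp _ _).inv ≫ D.F.map₂ (T.multNat f).hom ≫ (D.F.mapComp _ _).hom) ▷ D.actApp Y ≫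
        (α_ _ _ _).hom ≫ D.F.map (T.multApp X) ◁ (D.actNat f).hom =
      (α_ _ _ _).inv ≫ (D.actNat (T.S.map f)).hom ▷ D.actApp Y ≫ (α_ _ _ _).hom ≫
        D.actApp (T.S.obj X) ◁ (D.actNat f).hom ≫ (α_ _ _ _).inv ≫
        (m X).hom ▷ D.F.map f ≫ (α_ _ _ _).hom
  unit_coherence (X : A) :
    (λ_ _).inv ≫ (u (T.S.obj X)).hom ▷ D.actApp X ≫ (α_ _ _ _).hom ≫
        D.F.map (T.unitApp (T.S.obj X)) ◁ (m X).hom ≫ (α_ _ _ _).inv ≫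
        ((D.F.mapComp _ _).inv ≫ D.F.map₂ (T.lam X).inv ≫ (D.F.mapId _).hom) ▷ D.actApp X ≫ (λ_ _).hom =
      𝟙 (D.actApp X)
  assoc_coherence (X : A) :
    (α_ _ _ _).inv ≫ (m (T.S.obj X)).hom ▷ D.actApp X ≫ (α_ _ _ _).hom ≫
        D.F.map (T.multApp (T.S.obj X)) ◁ (m X).hom ≫ (α_ _ _ _).inv ≫
        ((D.F.mapComp _ _).inv ≫ D.F.map₂ (T.alpha X).inv ≫ (D.F.mapComp _ _).hom) ▷ D.actApp X ≫
        (α_ _ _ _).hom =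
      D.actApp (T.S.obj (T.S.obj X)) ◁ (m X).hom ≫ (α_ _ _ _).inv ≫
        (D.actNat (T.multApp X)).inv ▷ D.actApp X ≫ (α_ _ _ _).hom ≫
        D.F.map (T.S.map (T.multApp X)) ◁ (m X).hom

namespace GrayKleisli

variable {A : Type u} [Bicategory.{w, v} A] [Strict A] (T : Pseudomonad A)

/-- Formal composites of 1-cells of `A` and new generators `act X : S X ⟶ X`. -/
inductive Word : A → A → Type (max u v)
  | of {X Y : A} (f : X ⟶ Y) : Word X Y
  | act (X : A) : Word (T.S.obj X) X
  | id (X : A) : Word X X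
  | comp {X Y Z : A} (p : Word X Y) (q : Word Y Z) : Word X Z

/-- The axioms of a category, and the requirement that `of` preserve identities and composites. -/
inductive WordRel : {X Y : A} → Word T X Y → Word T X Y → Prop
  | comp_left {X Y Z : A} (p : Word T X Y) {q q' : Word T Y Z} :
      WordRel q q' → WordRel (.comp p q) (.comp p q')
  | comp_right {X Y Z : A} {p p' : Word T X Y} (q : Word T Y Z) :
      WordRel p p' → WordRel (.comp p q) (.comp p' q)
  | id_comp {X Y : A} (p : Word T X Y) : WordRel (.comp (.id X) p) p
  | comp_id {X Y : A} (p : Word T X Y) : WordRel (.comp p (.id Y)) p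
  | assoc {X Y Z W : A} (p : Word T X Y) (q : Word T Y Z) (r : Word T Z W) :
      WordRel (.comp (.comp p q) r) (.comp p (.comp q r))
  | of_id (X : A) : WordRel (.of (𝟙 X)) (.id X)
  | of_comp {X Y Z : A} (f : X ⟶ Y) (g : Y ⟶ Z) :
      WordRel (.of (f ≫ g)) (.comp (.of f) (.of g))

/-- The 1-cells of the Kleisli object: `A` with the 1-cells `act X : S X ⟶ X` freely adjoined. -/
def Cell (X Y : A) : Type (max u v) := Quot (WordRel T (X := X) (Y := Y))

namespace Cell

variable {T}

def of {X Y : A} (f : X ⟶ Y) : Cell T X Y := Quot.mk _ (.of f)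

variable (T) in
def act (X : A) : Cell T (T.S.obj X) X := Quot.mk _ (.act X)

variable (T) in
def id (X : A) : Cell T X X := Quot.mk _ (.id X)

def comp {X Y Z : A} (f : Cell T X Y) (g : Cell T Y Z) : Cell T X Z :=
  Quot.map₂ Word.comp (fun p _ _ => WordRel.comp_left p) (fun _ _ q => WordRel.comp_right q) f g

theorem id_comp {X Y : A} (f : Cell T X Y) : comp (id T X) f = f := by
  induction f using Quot.ind
  exact Quot.sound (.id_comp _)

theorem comp_id {X Y : A} (f : Cell T X Y) : comp f (id T Y) = f := by
  induction f using Quot.ind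
  exact Quot.sound (.comp_id _)

theorem assoc {X Y Z W : A} (f : Cell T X Y) (g : Cell T Y Z) (h : Cell T Z W) :
    comp (comp f g) h = comp f (comp g h) := by
  induction f using Quot.ind
  induction g using Quot.ind
  induction h using Quot.ind
  exact Quot.sound (.assoc _ _ _)

theorem of_id (X : A) : of (T := T) (𝟙 X) = id T X := Quot.sound (.of_id X)

theorem of_comp {X Y Z : A} (f : X ⟶ Y) (g : Y ⟶ Z) :
    of (T := T) (f ≫ g) = comp (of f) (of g) := Quot.sound (.of_comp f g)

end Cell

/-- The generating invertible 2-cells that are not in `A`. -/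
inductive Gen₂ : {X Y : A} → Cell T X Y → Cell T X Y → Type (max u v)
  | act {X Y : A} (f : X ⟶ Y) :
      Gen₂ ((Cell.of (T.S.map f)).comp (Cell.act T Y)) ((Cell.act T X).comp (Cell.of f))
  | u (X : A) : Gen₂ (Cell.id T X) ((Cell.of (T.unitApp X)).comp (Cell.act T X))
  | m (X : A) : Gen₂ ((Cell.act T (T.S.obj X)).comp (Cell.act T X))
      ((Cell.of (T.multApp X)).comp (Cell.act T X))

/-- Formal composites of 2-cells of `A`, the generators `Gen₂` and their inverses. -/
inductive Term : {X Y : A} → Cell T X Y → Cell T X Y → Type (max u v w)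
  | of {X Y : A} {f g : X ⟶ Y} (γ : f ⟶ g) : Term (.of f) (.of g)
  | gen {X Y : A} {f g : Cell T X Y} (x : Gen₂ T f g) : Term f g
  | genInv {X Y : A} {f g : Cell T X Y} (x : Gen₂ T f g) : Term g f
  | id {X Y : A} (f : Cell T X Y) : Term f f
  | vcomp {X Y : A} {f g h : Cell T X Y} (s : Term f g) (t : Term g h) : Term f h
  | whiskerLeft {X Y Z : A} (f : Cell T X Y) {g h : Cell T Y Z} (t : Term g h) :
      Term (f.comp g) (f.comp h)
  | whiskerRight {X Y Z : A} {f g : Cell T X Y} (t : Term f g) (h : Cell T Y Z) :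
      Term (f.comp h) (g.comp h)

namespace Term

variable {T}

/-- The identity 2-cell between equal 1-cells. -/
def eqTo {X Y : A} {f g : Cell T X Y} (h : f = g) : Term T f g := h ▸ id f

def asc {X Y Z W : A} (f : Cell T X Y) (g : Cell T Y Z) (h : Cell T Z W) :
    Term T ((f.comp g).comp h) (f.comp (g.comp h)) := eqTo (Cell.assoc f g h)

def ascInv {X Y Z W : A} (f : Cell T X Y) (g : Cell T Y Z) (h : Cell T Z W) :
    Term T (f.comp (g.comp h)) ((f.comp g).comp h) := eqTo (Cell.assoc f g h).symm

def lunit {X Y : A} (f : Cell T X Y) : Term T ((Cell.id T X).comp f) f := eqTo (Cell.id_comp f)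

def lunitInv {X Y : A} (f : Cell T X Y) : Term T f ((Cell.id T X).comp f) :=
  eqTo (Cell.id_comp f).symm

def runit {X Y : A} (f : Cell T X Y) : Term T (f.comp (Cell.id T Y)) f := eqTo (Cell.comp_id f)

def runitInv {X Y : A} (f : Cell T X Y) : Term T f (f.comp (Cell.id T Y)) :=
  eqTo (Cell.comp_id f).symm

def ofComp {X Y Z : A} (f : X ⟶ Y) (g : Y ⟶ Z) :
    Term T (.of (f ≫ g)) ((Cell.of f).comp (Cell.of g)) := eqTo (Cell.of_comp f g)

def ofCompInv {X Y Z : A} (f : X ⟶ Y) (g : Y ⟶ Z) :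
    Term T ((Cell.of f).comp (Cell.of g)) (.of (f ≫ g)) := eqTo (Cell.of_comp f g).symm

variable (T) in
def ofId (X : A) : Term T (.of (𝟙 X)) (Cell.id T X) := eqTo (Cell.of_id X)

end Term

infixr:80 "⬝" => Term.vcomp
infixr:81 "◃" => Term.whiskerLeft
infixl:81 "▹" => Term.whiskerRight

open Term in
/-- The relations between 2-cells of the Kleisli object. -/
inductive TermRel : {X Y : A} → {f g : Cell T X Y} → Term T f g → Term T f g → Prop
  -- congruence
  | vcomp_left {X Y : A} {f g h : Cell T X Y} (s : Term T f g) {t t' : Term T g h} :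
      TermRel t t' → TermRel (s ⬝ t) (s ⬝ t')
  | vcomp_right {X Y : A} {f g h : Cell T X Y} {s s' : Term T f g} (t : Term T g h) :
      TermRel s s' → TermRel (s ⬝ t) (s' ⬝ t)
  | whiskerLeft {X Y Z : A} (f : Cell T X Y) {g h : Cell T Y Z} {t t' : Term T g h} :
      TermRel t t' → TermRel (f ◃ t) (f ◃ t')
  | whiskerRight {X Y Z : A} {f g : Cell T X Y} {t t' : Term T f g} (h : Cell T Y Z) :
      TermRel t t' → TermRel (t ▹ h) (t' ▹ h)
  -- the axioms of a 2-category
  | id_vcomp {X Y : A} {f g : Cell T X Y} (t : Term T f g) : TermRel (.id f ⬝ t) t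
  | vcomp_id {X Y : A} {f g : Cell T X Y} (t : Term T f g) : TermRel (t ⬝ .id g) t
  | vcomp_assoc {X Y : A} {f g h k : Cell T X Y} (s : Term T f g) (t : Term T g h)
      (r : Term T h k) : TermRel ((s ⬝ t) ⬝ r) (s ⬝ t ⬝ r)
  | whiskerLeft_id {X Y Z : A} (f : Cell T X Y) (g : Cell T Y Z) :
      TermRel (f ◃ .id g) (.id (f.comp g))
  | whiskerLeft_vcomp {X Y Z : A} (f : Cell T X Y) {g h k : Cell T Y Z} (s : Term T g h)
      (t : Term T h k) : TermRel (f ◃ (s ⬝ t)) (f ◃ s ⬝ f ◃ t)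
  | id_whiskerLeft {X Y : A} {f g : Cell T X Y} (t : Term T f g) :
      TermRel (Cell.id T X ◃ t) (lunit f ⬝ t ⬝ lunitInv g)
  | comp_whiskerLeft {X Y Z W : A} (f : Cell T X Y) (g : Cell T Y Z) {h k : Cell T Z W}
      (t : Term T h k) : TermRel (f.comp g ◃ t) (asc f g h ⬝ f ◃ g ◃ t ⬝ ascInv f g k)
  | id_whiskerRight {X Y Z : A} (f : Cell T X Y) (g : Cell T Y Z) :
      TermRel (.id f ▹ g) (.id (f.comp g))
  | vcomp_whiskerRight {X Y Z : A} {f g h : Cell T X Y} (s : Term T f g) (t : Term T g h)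
      (k : Cell T Y Z) : TermRel ((s ⬝ t) ▹ k) (s ▹ k ⬝ t ▹ k)
  | whiskerRight_id {X Y : A} {f g : Cell T X Y} (t : Term T f g) :
      TermRel (t ▹ Cell.id T Y) (runit f ⬝ t ⬝ runitInv g)
  | whiskerRight_comp {X Y Z W : A} {f g : Cell T X Y} (t : Term T f g) (h : Cell T Y Z)
      (k : Cell T Z W) : TermRel (t ▹ h.comp k) (ascInv f h k ⬝ t ▹ h ▹ k ⬝ asc g h k)
  | whisker_assoc {X Y Z W : A} (f : Cell T X Y) {g h : Cell T Y Z} (t : Term T g h)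
      (k : Cell T Z W) : TermRel ((f ◃ t) ▹ k) (asc f g k ⬝ f ◃ (t ▹ k) ⬝ ascInv f h k)
  | whisker_exchange {X Y Z : A} {f g : Cell T X Y} {h k : Cell T Y Z} (s : Term T f g)
      (t : Term T h k) : TermRel (f ◃ t ⬝ s ▹ k) (s ▹ h ⬝ g ◃ t)
  -- the generators `act f`, `u X`, `m X` are invertible
  | gen_inv {X Y : A} {f g : Cell T X Y} (x : Gen₂ T f g) :
      TermRel (.gen x ⬝ .genInv x) (.id f)
  | inv_gen {X Y : A} {f g : Cell T X Y} (x : Gen₂ T f g) :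
      TermRel (.genInv x ⬝ .gen x) (.id g)
  -- the inclusion of `A` is a 2-functor
  | of_id {X Y : A} (f : X ⟶ Y) : TermRel (.of (𝟙 f)) (.id (.of f))
  | of_comp {X Y : A} {f g h : X ⟶ Y} (γ : f ⟶ g) (δ : g ⟶ h) :
      TermRel (.of (γ ≫ δ)) (.of γ ⬝ .of δ)
  | of_whiskerLeft {X Y Z : A} (f : X ⟶ Y) {g h : Y ⟶ Z} (γ : g ⟶ h) :
      TermRel (.of (f ◁ γ)) (ofComp f g ⬝ Cell.of f ◃ .of γ ⬝ ofCompInv f h)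
  | of_whiskerRight {X Y Z : A} {f g : X ⟶ Y} (γ : f ⟶ g) (h : Y ⟶ Z) :
      TermRel (.of (γ ▷ h)) (ofComp f h ⬝ .of γ ▹ Cell.of h ⬝ ofCompInv g h)
  -- `act` is a pseudonatural transformation
  | act_naturality {X Y : A} {f g : X ⟶ Y} (γ : f ⟶ g) :
      TermRel (.of (T.S.map₂ γ) ▹ Cell.act T Y ⬝ .gen (.act g))
        (.gen (.act f) ⬝ Cell.act T X ◃ .of γ)
  | act_id (X : A) :
      TermRel (.gen (.act (𝟙 X)) ⬝ Cell.act T X ◃ ofId T X)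
        ((.of (T.S.mapId X).hom ⬝ ofId T (T.S.obj X)) ▹ Cell.act T X ⬝
          lunit (Cell.act T X) ⬝ runitInv (Cell.act T X))
  | act_comp {X Y Z : A} (f : X ⟶ Y) (g : Y ⟶ Z) :
      TermRel (.gen (.act (f ≫ g)) ⬝ Cell.act T X ◃ ofComp f g)
        ((.of (T.S.mapComp f g).hom ⬝ ofComp (T.S.map f) (T.S.map g)) ▹ Cell.act T Z ⬝
          asc _ _ _ ⬝ Cell.of (T.S.map f) ◃ .gen (.act g) ⬝ ascInv _ _ _ ⬝
          .gen (.act f) ▹ Cell.of g ⬝ asc _ _ _)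
  -- `u` and `m` are modifications
  | u_naturality {X Y : A} (f : X ⟶ Y) :
      TermRel
        (Cell.of f ◃ .gen (.u Y) ⬝ ascInv _ _ _ ⬝
          (ofCompInv f (T.unitApp Y) ⬝ .of (T.unitNat f).hom ⬝
            ofComp (T.unitApp X) (T.S.map f)) ▹ Cell.act T Y ⬝
          asc _ _ _ ⬝ Cell.of (T.unitApp X) ◃ .gen (.act f))
        (runit _ ⬝ lunitInv _ ⬝ .gen (.u X) ▹ Cell.of f ⬝ asc _ _ _)
  | m_naturality {X Y : A} (f : X ⟶ Y) :
      TermRel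
        (Cell.of (T.S.map (T.S.map f)) ◃ .gen (.m Y) ⬝ ascInv _ _ _ ⬝
          (ofCompInv (T.S.map (T.S.map f)) (T.multApp Y) ⬝ .of (T.multNat f).hom ⬝
            ofComp (T.multApp X) (T.S.map f)) ▹ Cell.act T Y ⬝
          asc _ _ _ ⬝ Cell.of (T.multApp X) ◃ .gen (.act f))
        (ascInv _ _ _ ⬝ .gen (.act (T.S.map f)) ▹ Cell.act T Y ⬝ asc _ _ _ ⬝
          Cell.act T (T.S.obj X) ◃ .gen (.act f) ⬝ ascInv _ _ _ ⬝
          .gen (.m X) ▹ Cell.of f ⬝ asc _ _ _)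
  -- the two coherence axioms of a pseudoalgebra
  | unit_coherence (X : A) :
      TermRel
        (lunitInv (Cell.act T X) ⬝ .gen (.u (T.S.obj X)) ▹ Cell.act T X ⬝ asc _ _ _ ⬝
          Cell.of (T.unitApp (T.S.obj X)) ◃ .gen (.m X) ⬝ ascInv _ _ _ ⬝
          (ofCompInv (T.unitApp (T.S.obj X)) (T.multApp X) ⬝ .of (T.lam X).inv ⬝
            ofId T (T.S.obj X)) ▹ Cell.act T X ⬝ lunit (Cell.act T X))
        (.id (Cell.act T X))
  | assoc_coherence (X : A) :
      TermRel
        (ascInv _ _ _ ⬝ .gen (.m (T.S.obj X)) ▹ Cell.act T X ⬝ asc _ _ _ ⬝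
          Cell.of (T.multApp (T.S.obj X)) ◃ .gen (.m X) ⬝ ascInv _ _ _ ⬝
          (ofCompInv (T.multApp (T.S.obj X)) (T.multApp X) ⬝ .of (T.alpha X).inv ⬝
            ofComp (T.S.map (T.multApp X)) (T.multApp X)) ▹ Cell.act T X ⬝ asc _ _ _)
        (Cell.act T (T.S.obj (T.S.obj X)) ◃ .gen (.m X) ⬝ ascInv _ _ _ ⬝
          .genInv (.act (T.multApp X)) ▹ Cell.act T X ⬝ asc _ _ _ ⬝
          Cell.of (T.S.map (T.multApp X)) ◃ .gen (.m X))

end GrayKleisli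

/-- The `Gray`-enriched Kleisli object `A_S` of a pseudomonad, given by its presentation: the objects
are those of `A`, the 1-cells are `GrayKleisli.Cell`, and the 2-cells are the classes of
`GrayKleisli.Term` modulo `GrayKleisli.TermRel`. -/
@[ext]
structure GrayKleisli {A : Type u} [Bicategory.{w, v} A] [Strict A] (T : Pseudomonad A) where
  as : A

namespace GrayKleisli

variable {A : Type u} [Bicategory.{w, v} A] [Strict A] (T : Pseudomonad A)

/-- The 2-cells of the Kleisli object. -/
def Hom₂ {X Y : A} (f g : Cell T X Y) : Type (max u v w) := Quot (TermRel T (f := f) (g := g))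

instance categoryStruct : CategoryStruct.{max u v} (GrayKleisli T) where
  Hom X Y := Cell T X.as Y.as
  id X := Cell.id T X.as
  comp f g := Cell.comp f g

instance homCategory (X Y : GrayKleisli T) : Category.{max u v w} (X ⟶ Y) where
  Hom f g := Hom₂ T (X := X.as) (Y := Y.as) f g
  id f := Quot.mk _ (.id f)
  comp s t := Quot.map₂ Term.vcomp (fun s _ _ => TermRel.vcomp_left s)
    (fun _ _ t => TermRel.vcomp_right t) s t
  id_comp := by rintro f g ⟨t⟩; exact Quot.sound (.id_vcomp t)
  comp_id := by rintro f g ⟨t⟩; exact Quot.sound (.vcomp_id t)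
  assoc := by rintro f g h k ⟨s⟩ ⟨t⟩ ⟨r⟩; exact Quot.sound (.vcomp_assoc s t r)

def mk₂ {X Y : GrayKleisli T} {f g : X ⟶ Y} (t : Term T (X := X.as) (Y := Y.as) f g) : f ⟶ g :=
  Quot.mk _ t

theorem mk₂_eqTo {X Y : GrayKleisli T} {f g : X ⟶ Y} (h : f = g) :
    mk₂ T (Term.eqTo h) = eqToHom h := by
  cases h; rfl

theorem mk₂_vcomp {X Y : GrayKleisli T} {f g h : X ⟶ Y}
    (s : Term T (X := X.as) (Y := Y.as) f g) (t : Term T (X := X.as) (Y := Y.as) g h) :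
    mk₂ T (s.vcomp t) = mk₂ T s ≫ mk₂ T t := rfl

theorem sound {X Y : GrayKleisli T} {f g : X ⟶ Y} {s t : Term T (X := X.as) (Y := Y.as) f g}
    (h : TermRel T s t) : mk₂ T s = mk₂ T t := Quot.sound h

def wl {X Y Z : GrayKleisli T} (f : X ⟶ Y) {g h : Y ⟶ Z} (t : g ⟶ h) : f ≫ g ⟶ f ≫ h :=
  Quot.map (Term.whiskerLeft f) (fun _ _ => TermRel.whiskerLeft f) t

def wr {X Y Z : GrayKleisli T} {f g : X ⟶ Y} (t : f ⟶ g) (h : Y ⟶ Z) : f ≫ h ⟶ g ≫ h :=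
  Quot.map (fun t => Term.whiskerRight t h) (fun _ _ => TermRel.whiskerRight h) t

theorem wl_eqToHom {X Y Z : GrayKleisli T} (f : X ⟶ Y) {g h : Y ⟶ Z} (e : g = h) :
    wl T f (eqToHom e) = eqToHom (congrArg (fun x => f ≫ x) e) := by
  cases e; exact Quot.sound (.whiskerLeft_id f g)

theorem wr_eqToHom {X Y Z : GrayKleisli T} {f g : X ⟶ Y} (e : f = g) (h : Y ⟶ Z) :
    wr T (eqToHom e) h = eqToHom (congrArg (fun x => x ≫ h) e) := by
  cases e; exact Quot.sound (.id_whiskerRight f h)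

instance bicategory : Bicategory.{max u v w, max u v} (GrayKleisli T) where
  homCategory := homCategory T
  whiskerLeft f _ _ t := wl T f t
  whiskerRight t h := wr T t h
  associator f g h := eqToIso (Cell.assoc f g h)
  leftUnitor f := eqToIso (Cell.id_comp f)
  rightUnitor f := eqToIso (Cell.comp_id f)
  whiskerLeft_id f g := Quot.sound (.whiskerLeft_id f g)
  whiskerLeft_comp := by rintro _ _ _ f _ _ _ ⟨s⟩ ⟨t⟩; exact Quot.sound (.whiskerLeft_vcomp f s t)
  id_whiskerLeft := by
    rintro _ _ f g ⟨t⟩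
    simp only [eqToIso.hom, eqToIso.inv, ← mk₂_eqTo]
    exact Quot.sound (.id_whiskerLeft t)
  comp_whiskerLeft := by
    rintro _ _ _ _ f g h k ⟨t⟩
    simp only [eqToIso.hom, eqToIso.inv, ← mk₂_eqTo]
    exact Quot.sound (.comp_whiskerLeft f g t)
  id_whiskerRight f g := Quot.sound (.id_whiskerRight f g)
  comp_whiskerRight := by
    rintro _ _ _ _ _ _ ⟨s⟩ ⟨t⟩ k; exact Quot.sound (.vcomp_whiskerRight s t k)
  whiskerRight_id := by
    rintro _ _ f g ⟨t⟩
    simp only [eqToIso.hom, eqToIso.inv, ← mk₂_eqTo]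
    exact Quot.sound (.whiskerRight_id t)
  whiskerRight_comp := by
    rintro _ _ _ _ f g ⟨t⟩ h k
    simp only [eqToIso.hom, eqToIso.inv, ← mk₂_eqTo]
    exact Quot.sound (.whiskerRight_comp t h k)
  whisker_assoc := by
    rintro _ _ _ _ f g h ⟨t⟩ k
    simp only [eqToIso.hom, eqToIso.inv, ← mk₂_eqTo]
    exact Quot.sound (.whisker_assoc f t k)
  whisker_exchange := by
    rintro _ _ _ f g h k ⟨s⟩ ⟨t⟩
    exact Quot.sound (.whisker_exchange s t)
  pentagon f g h k := by
    simp only [eqToIso.hom, wl_eqToHom, wr_eqToHom, eqToHom_trans]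
  triangle f g := by
    simp only [eqToIso.hom, wl_eqToHom, wr_eqToHom, eqToHom_trans]

instance strict : Strict (GrayKleisli T) where
  id_comp f := Cell.id_comp f
  comp_id f := Cell.comp_id f
  assoc f g h := Cell.assoc f g h

end GrayKleisli

namespace KleisliCocone

open GrayKleisli

variable {A : Type u} [Bicategory.{w, v} A] [Strict A] {T : Pseudomonad A}
  {C : Type u'} [Bicategory.{w', v'} C] [Strict C] (c : KleisliCocone T C)

/-- The value of a formal composite of 1-cells in a cocone. -/
def valWord : {X Y : A} → Word T X Y → (c.F.obj X ⟶ c.F.obj Y)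
  | _, _, .of f => c.F.map f
  | _, _, .act X => c.actApp X
  | _, _, .id X => 𝟙 (c.F.obj X)
  | _, _, .comp p q => valWord p ≫ valWord q

theorem valWord_eq {X Y : A} {p q : Word T X Y} (h : WordRel T p q) :
    c.valWord p = c.valWord q := by
  induction h with
  | comp_left p _ ih => simp only [valWord, ih]
  | comp_right q _ ih => simp only [valWord, ih]
  | id_comp p => exact Strict.id_comp _
  | comp_id p => exact Strict.comp_id _
  | assoc p q r => exact Strict.assoc _ _ _
  | of_id X => exact c.F.map_id X
  | of_comp f g => exact c.F.map_comp f g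

def valCell {X Y : A} (f : Cell T X Y) : c.F.obj X ⟶ c.F.obj Y :=
  Quot.lift c.valWord (fun _ _ => c.valWord_eq) f

theorem valCell_comp {X Y Z : A} (f : Cell T X Y) (g : Cell T Y Z) :
    c.valCell (f.comp g) = c.valCell f ≫ c.valCell g := by
  induction f using Quot.ind
  induction g using Quot.ind
  rfl

def valGen : {X Y : A} → {f g : Cell T X Y} → Gen₂ T f g → (c.valCell f ≅ c.valCell g)
  | _, _, _, _, .act f => c.actNat f
  | _, _, _, _, .u X => c.u X
  | _, _, _, _, .m X => c.m X

/-- The value of a formal composite of 2-cells in a cocone. -/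
def valTerm : {X Y : A} → {f g : Cell T X Y} → Term T f g → (c.valCell f ⟶ c.valCell g)
  | _, _, _, _, .of γ => c.F.map₂ γ
  | _, _, _, _, .gen x => (c.valGen x).hom
  | _, _, _, _, .genInv x => (c.valGen x).inv
  | _, _, _, _, .id f => 𝟙 (c.valCell f)
  | _, _, _, _, .vcomp s t => valTerm s ≫ valTerm t
  | _, _, _, _, .whiskerLeft (g := g) (h := h) f t =>
      cast (by rw [c.valCell_comp, c.valCell_comp]) (c.valCell f ◁ valTerm t)
  | _, _, _, _, .whiskerRight (f := f) (g := g) t h =>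
      cast (by rw [c.valCell_comp, c.valCell_comp]) (valTerm t ▷ c.valCell h)

theorem cast_hom {X Y : C} {f f' g g' : X ⟶ Y} (hf : f = f') (hg : g = g') (t : f ⟶ g)
    (h : (f ⟶ g) = (f' ⟶ g')) : cast h t = eqToHom hf.symm ≫ t ≫ eqToHom hg := by
  cases hf; cases hg; simp

theorem valTerm_whiskerLeft {X Y Z : A} (f : Cell T X Y) {g h : Cell T Y Z} (t : Term T g h) :
    c.valTerm (t.whiskerLeft f) = eqToHom (c.valCell_comp f g) ≫ c.valCell f ◁ c.valTerm t ≫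
        eqToHom (c.valCell_comp f h).symm :=
  cast_hom (c.valCell_comp _ _).symm (c.valCell_comp _ _).symm _ _

theorem valTerm_whiskerRight {X Y Z : A} {f g : Cell T X Y} (t : Term T f g) (h : Cell T Y Z) :
    c.valTerm (t.whiskerRight h) = eqToHom (c.valCell_comp f h) ≫ c.valTerm t ▷ c.valCell h ≫
        eqToHom (c.valCell_comp g h).symm :=
  cast_hom (c.valCell_comp _ _).symm (c.valCell_comp _ _).symm _ _

theorem valTerm_id {X Y : A} (f : Cell T X Y) : c.valTerm (.id f) = 𝟙 (c.valCell f) := rfl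

theorem valTerm_vcomp {X Y : A} {f g h : Cell T X Y} (s : Term T f g) (t : Term T g h) :
    c.valTerm (s.vcomp t) = c.valTerm s ≫ c.valTerm t := rfl

theorem valTerm_eqTo {X Y : A} {f g : Cell T X Y} (h : f = g) :
    c.valTerm (Term.eqTo h) = eqToHom (congrArg c.valCell h) := by
  cases h; rfl


theorem conj_whiskerLeft {X Y Z : C} {f f' : X ⟶ Y} (e : f = f') {g h : Y ⟶ Z} (t : g ⟶ h) :
    f ◁ t = eqToHom (by rw [e]) ≫ f' ◁ t ≫ eqToHom (by rw [e]) := by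
  cases e; simp

theorem conj_whiskerRight {X Y Z : C} {h h' : Y ⟶ Z} (e : h = h') {f g : X ⟶ Y} (t : f ⟶ g) :
    t ▷ h = eqToHom (by rw [e]) ≫ t ▷ h' ≫ eqToHom (by rw [e]) := by
  cases e; simp

theorem valTerm_eq {X Y : A} {f g : Cell T X Y} {s t : Term T f g} (h : TermRel T s t) :
    c.valTerm s = c.valTerm t := by
  induction h with
  | vcomp_left s _ ih => simp only [valTerm, ih]
  | vcomp_right t _ ih => simp only [valTerm, ih]
  | whiskerLeft f _ ih => simp only [valTerm, ih]
  | whiskerRight h _ ih => simp only [valTerm, ih]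
  | id_vcomp t => simp only [valTerm, Category.id_comp]
  | vcomp_id t => simp only [valTerm, Category.comp_id]
  | vcomp_assoc s t r => simp only [valTerm, Category.assoc]
  | whiskerLeft_id f g => simp [valTerm_whiskerLeft, valTerm_id]
  | whiskerLeft_vcomp f s t => simp [valTerm_whiskerLeft, valTerm_vcomp]
  | id_whiskerLeft t =>
    simp only [Term.lunit, Term.lunitInv, valTerm_vcomp, valTerm_eqTo]
    rw [valTerm_whiskerLeft, conj_whiskerLeft (show c.valCell (Cell.id T _) = 𝟙 _ from rfl)]
    simp [Strict.leftUnitor_eqToIso]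
  | comp_whiskerLeft f g t =>
    simp only [Term.asc, Term.ascInv, valTerm_whiskerLeft, valTerm_vcomp, valTerm_eqTo]
    rw [conj_whiskerLeft (c.valCell_comp f g)]
    simp [Strict.associator_eqToIso]
  | id_whiskerRight f g => simp [valTerm_whiskerRight, valTerm_id]
  | vcomp_whiskerRight s t k => simp [valTerm_whiskerRight, valTerm_vcomp]
  | whiskerRight_id t =>
    simp only [Term.runit, Term.runitInv, valTerm_vcomp, valTerm_eqTo]
    rw [valTerm_whiskerRight, conj_whiskerRight (show c.valCell (Cell.id T _) = 𝟙 _ from rfl)]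
    simp [Strict.rightUnitor_eqToIso]
  | whiskerRight_comp t h k =>
    simp only [Term.asc, Term.ascInv, valTerm_whiskerRight, valTerm_vcomp, valTerm_eqTo]
    rw [conj_whiskerRight (c.valCell_comp h k)]
    simp [Strict.associator_eqToIso]
  | whisker_assoc f t k =>
    simp only [Term.asc, Term.ascInv, valTerm_whiskerRight, valTerm_whiskerLeft, valTerm_vcomp,
      valTerm_eqTo]
    simp [Strict.associator_eqToIso]
  | whisker_exchange s t =>
    simp [valTerm_whiskerRight, valTerm_whiskerLeft, valTerm_vcomp, whisker_exchange_assoc]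
  | gen_inv x => simp [valTerm]
  | inv_gen x => simp [valTerm]
  | of_id f => exact c.F.map₂_id f
  | of_comp γ δ => exact c.F.map₂_comp γ δ
  | of_whiskerLeft f γ =>
    have := c.F.map₂_whisker_left f γ
    simp only [c.F.mapComp_eq_eqToIso, eqToIso.hom, eqToIso.inv] at this
    simp only [Term.ofComp, Term.ofCompInv, valTerm, valTerm_eqTo]
    exact this
  | of_whiskerRight γ h =>
    have := c.F.map₂_whisker_right γ h
    simp only [c.F.mapComp_eq_eqToIso, eqToIso.hom, eqToIso.inv] at this
    simp only [Term.ofComp, Term.ofCompInv, valTerm, valTerm_eqTo]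
    exact this
  | act_naturality γ => exact c.act.naturality_naturality γ
  | act_id X =>
    have := c.act.naturality_id X
    simp only [c.F.mapId_eq_eqToIso, Pseudofunctor.comp_mapId, eqToIso.hom, eqToIso.inv, Strict.leftUnitor_eqToIso,
      Strict.rightUnitor_eqToIso] at this
    simp only [Term.ofId, Term.lunit, Term.runitInv, valTerm, valTerm_eqTo]
    exact this
  | act_comp f g =>
    have := c.act.naturality_comp f g
    simp only [c.F.mapComp_eq_eqToIso, Pseudofunctor.comp_mapComp, eqToIso.hom, eqToIso.inv, Strict.associator_eqToIso] at this
    simp only [Term.ofComp, Term.asc, Term.ascInv, valTerm, valTerm_eqTo]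
    exact this
  | u_naturality f =>
    have := c.u_naturality f
    simp only [c.F.mapComp_eq_eqToIso, eqToIso.hom, eqToIso.inv, Strict.associator_eqToIso,
      Strict.leftUnitor_eqToIso, Strict.rightUnitor_eqToIso] at this
    simp only [Term.ofComp, Term.ofCompInv, Term.asc, Term.ascInv, Term.lunitInv, Term.runit,
      valTerm, valTerm_eqTo]
    exact this
  | m_naturality f =>
    have := c.m_naturality f
    simp only [c.F.mapComp_eq_eqToIso, eqToIso.hom, eqToIso.inv, Strict.associator_eqToIso] at this
    simp only [Term.ofComp, Term.ofCompInv, Term.asc, Term.ascInv, valTerm, valTerm_eqTo]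
    exact this
  | unit_coherence X =>
    have := c.unit_coherence X
    simp only [c.F.mapComp_eq_eqToIso, c.F.mapId_eq_eqToIso, eqToIso.hom, eqToIso.inv,
      Strict.associator_eqToIso, Strict.leftUnitor_eqToIso] at this
    simp only [Term.ofCompInv, Term.ofId, Term.asc, Term.ascInv, Term.lunit, Term.lunitInv,
      valTerm, valTerm_eqTo]
    exact this
  | assoc_coherence X =>
    have := c.assoc_coherence X
    simp only [c.F.mapComp_eq_eqToIso, eqToIso.hom, eqToIso.inv, Strict.associator_eqToIso] at this
    simp only [Term.ofComp, Term.ofCompInv, Term.asc, Term.ascInv, valTerm, valTerm_eqTo]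
    exact this

/-- The 2-functor out of the Kleisli object induced by a cocone: it is `c.F` on the data from `A`, and
sends the generators `act X`, `act f`, `u X`, `m X` to the corresponding data of `c`. -/
def desc : StrictPseudofunctor (GrayKleisli T) C :=
  StrictPseudofunctor.mk''
    { obj := fun X => c.F.obj X.as
      map := fun f => c.valCell f
      map₂ := fun t => Quot.lift c.valTerm (fun _ _ => c.valTerm_eq) t
      map₂_id := fun _ => rfl
      map₂_comp := by rintro _ _ _ _ _ ⟨s⟩ ⟨t⟩; rfl
      map_id := fun _ => rfl
      map_comp := fun f g => c.valCell_comp f g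
      map₂_whisker_left := by
        rintro _ _ _ f g h ⟨t⟩; exact c.valTerm_whiskerLeft f t
      map₂_whisker_right := by
        rintro _ _ _ f g ⟨t⟩ h; exact c.valTerm_whiskerRight t h }

end KleisliCocone

namespace Pseudoadjunction

variable {A : Type u} [Bicategory.{w, v} A] [Strict A]
  {B : Type u'} [Bicategory.{w', v'} B] [Strict B] (adj : Pseudoadjunction A B)

theorem counitNat_naturality {Y Z : B} {f g : Y ⟶ Z} (γ : f ⟶ g) :
    adj.F.map₂ (adj.U.map₂ γ) ▷ adj.counitApp Z ≫ (adj.counitNat g).hom =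
      (adj.counitNat f).hom ≫ adj.counitApp Y ◁ γ :=
  adj.counit.naturality_naturality γ

theorem counitNat_id (Y : B) :
    (adj.counitNat (𝟙 Y)).hom = (adj.F.map₂ (adj.U.mapId Y).hom ≫
      (adj.F.mapId _).hom) ▷ adj.counitApp Y ≫ (λ_ _).hom ≫ (ρ_ _).inv := by
  refine Eq.trans ?_ (adj.counit.naturality_id Y)
  exact ((congrArg _ (Bicategory.whiskerLeft_id _ _)).trans (Category.comp_id _)).symm

theorem counitNat_comp {X Y Z : B} (f : X ⟶ Y) (g : Y ⟶ Z) :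
    (adj.counitNat (f ≫ g)).hom = (adj.F.map₂ (adj.U.mapComp f g).hom ≫
      (adj.F.mapComp _ _).hom) ▷ adj.counitApp Z ≫ (α_ _ _ _).hom ≫
      adj.F.map (adj.U.map f) ◁ (adj.counitNat g).hom ≫ (α_ _ _ _).inv ≫
      (adj.counitNat f).hom ▷ g ≫ (α_ _ _ _).hom := by
  refine Eq.trans ?_ (adj.counit.naturality_comp f g)
  exact ((congrArg _ (Bicategory.whiskerLeft_id _ _)).trans (Category.comp_id _)).symm

attribute [local simp] StrictPseudofunctor.mapComp_eq_eqToIso Strict.associator_eqToIso Strict.leftUnitor_eqToIso Strict.rightUnitor_eqToIso PrelaxFunctor.map₂_eqToHom StrictlyUnitaryPseudofunctor.mapId_eq_eqToIso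

def mNat {X Y : A} (f : X ⟶ Y) :
    adj.U.map (adj.F.map (adj.U.map (adj.F.map f))) ≫ adj.U.map (adj.counitApp (adj.F.obj Y)) ≅
      adj.U.map (adj.counitApp (adj.F.obj X)) ≫ adj.U.map (adj.F.map f) :=
  (adj.U.mapComp _ _).symm ≪≫ adj.U.map₂Iso (adj.counitNat (adj.F.map f)) ≪≫ adj.U.mapComp _ _

theorem counitNat_congr {Y Z : B} {f g : Y ⟶ Z} (h : f = g) :
    (adj.counitNat f).hom = eqToHom (by rw [h]) ≫ (adj.counitNat g).hom ≫ eqToHom (by rw [h]) := by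
  cases h; simp

theorem mNat_naturality {X Y : A} {f g : X ⟶ Y} (γ : f ⟶ g) :
    adj.U.map₂ (adj.F.map₂ (adj.U.map₂ (adj.F.map₂ γ))) ▷ adj.U.map (adj.counitApp (adj.F.obj Y)) ≫
      (adj.mNat g).hom =
    (adj.mNat f).hom ≫ adj.U.map (adj.counitApp (adj.F.obj X)) ◁ adj.U.map₂ (adj.F.map₂ γ) := by
  have := congrArg adj.U.map₂ (adj.counitNat_naturality (adj.F.map₂ γ))
  rw [← cancel_epi (adj.U.mapComp _ _).hom, ← cancel_mono (adj.U.mapComp _ _).inv]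
  simpa [mNat] using this

theorem mNat_id (X : A) : (adj.mNat (𝟙 X)).hom ≫
    adj.U.map (adj.counitApp (adj.F.obj X)) ◁ (adj.U.map₂ (adj.F.mapId X).hom ≫ (adj.U.mapId _).hom) = 
    (adj.U.map₂ (adj.F.map₂ (adj.U.map₂ (adj.F.mapId X).hom ≫ (adj.U.mapId _).hom)) ≫
     adj.U.map₂ (adj.F.mapId _).hom ≫ (adj.U.mapId _).hom) ▷ adj.U.map (adj.counitApp (adj.F.obj X)) ≫ 
     (λ_ _).hom ≫ (ρ_ _).inv := by
  simp [mNat]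
  rw [adj.counitNat_congr (adj.F.map_id X), counitNat_id]
  simp

theorem mNat_comp {X Y Z : A} (f : X ⟶ Y) (g : Y ⟶ Z) : (adj.mNat (f ≫ g)).hom ≫
    adj.U.map (adj.counitApp (adj.F.obj X)) ◁ 
     (adj.U.map₂ (adj.F.mapComp f g).hom ≫ (adj.U.mapComp _ _).hom) = 
    (adj.U.map₂ (adj.F.map₂ (adj.U.map₂ (adj.F.mapComp f g).hom ≫ (adj.U.mapComp _ _).hom)) ≫
     adj.U.map₂ (adj.F.mapComp _ _).hom ≫ (adj.U.mapComp _ _).hom) ▷ adj.U.map (adj.counitApp (adj.F.obj Z)) ≫ 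
     (α_ _ _ _).hom ≫ adj.U.map (adj.F.map (adj.U.map (adj.F.map f))) ◁ (adj.mNat g).hom ≫
     (α_ _ _ _).inv ≫ (adj.mNat f).hom ▷ adj.U.map (adj.F.map g) ≫ (α_ _ _ _).hom := by
  simp [mNat]
  rw [adj.counitNat_congr (adj.F.map_comp f g), counitNat_comp]
  simp


theorem counit_counit {Y Z : B} (g : Y ⟶ Z) :
    (α_ _ _ _).inv ≫ ((adj.F.mapComp _ _).inv ≫ adj.F.map₂ ((adj.U.mapComp _ _).inv ≫
        adj.U.map₂ (adj.counitNat g).hom ≫ (adj.U.mapComp _ _).hom) ≫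
        (adj.F.mapComp _ _).hom) ▷ adj.counitApp Z ≫ (α_ _ _ _).hom ≫
        adj.F.map (adj.U.map (adj.counitApp Y)) ◁ (adj.counitNat g).hom ≫ (α_ _ _ _).inv ≫
        (adj.counitNat (adj.counitApp Y)).hom ▷ g =
      adj.F.map (adj.U.map (adj.F.map (adj.U.map g))) ◁ (adj.counitNat (adj.counitApp Z)).hom ≫
        (α_ _ _ _).inv ≫ (adj.counitNat (adj.F.map (adj.U.map g))).hom ▷ adj.counitApp Z ≫
        (α_ _ _ _).hom ≫ adj.counitApp (adj.F.obj (adj.U.obj Y)) ◁ (adj.counitNat g).hom ≫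
        (α_ _ _ _).inv := by
  have := adj.counitNat_naturality (adj.counitNat g).hom
  simp only [counitNat_comp] at this
  rw [← cancel_epi (eqToHom (by simp [StrictPseudofunctor.map_comp]) :
    adj.F.map (adj.U.map (adj.F.map (adj.U.map g) ≫ adj.counitApp Z)) ≫ adj.counitApp Z ⟶ _),
    ← cancel_mono (α_ _ _ _).hom]
  simpa using this

theorem mult_mult {Y Z : B} (g : Y ⟶ Z) :
    (α_ _ _ _).inv ≫ (((adj.U.mapComp _ _).inv ≫ adj.U.map₂ (adj.F.mapComp _ _).inv) ≫
        adj.U.map₂ (adj.F.map₂ ((adj.U.mapComp _ _).inv ≫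
        adj.U.map₂ (adj.counitNat g).hom ≫ (adj.U.mapComp _ _).hom)) ≫
        (adj.U.map₂ (adj.F.mapComp _ _).hom ≫ (adj.U.mapComp _ _).hom)) ▷ adj.U.map (adj.counitApp Z) ≫ (α_ _ _ _).hom ≫
        adj.U.map (adj.F.map (adj.U.map (adj.counitApp Y))) ◁ ((adj.U.mapComp _ _).inv ≫
        adj.U.map₂ (adj.counitNat g).hom ≫ (adj.U.mapComp _ _).hom) ≫ (α_ _ _ _).inv ≫
        ((adj.U.mapComp _ _).inv ≫ adj.U.map₂ (adj.counitNat (adj.counitApp Y)).hom ≫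
          (adj.U.mapComp _ _).hom) ▷ adj.U.map g =
      adj.U.map (adj.F.map (adj.U.map (adj.F.map (adj.U.map g)))) ◁
          ((adj.U.mapComp _ _).inv ≫ adj.U.map₂ (adj.counitNat (adj.counitApp Z)).hom ≫
          (adj.U.mapComp _ _).hom) ≫
        (α_ _ _ _).inv ≫ ((adj.U.mapComp _ _).inv ≫
          adj.U.map₂ (adj.counitNat (adj.F.map (adj.U.map g))).hom ≫ (adj.U.mapComp _ _).hom) ▷
          adj.U.map (adj.counitApp Z) ≫
        (α_ _ _ _).hom ≫ adj.U.map (adj.counitApp (adj.F.obj (adj.U.obj Y))) ◁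
          ((adj.U.mapComp _ _).inv ≫ adj.U.map₂ (adj.counitNat g).hom ≫
          (adj.U.mapComp _ _).hom) ≫ (α_ _ _ _).inv := by
  have := congrArg adj.U.map₂ (adj.counit_counit g)
  rw [← cancel_epi (eqToHom (by simp [StrictPseudofunctor.map_comp]) :
    adj.U.map (adj.F.map (adj.U.map (adj.F.map (adj.U.map g))) ≫
      adj.F.map (adj.U.map (adj.counitApp Z)) ≫ adj.counitApp Z) ⟶ _),
    ← cancel_mono (eqToHom (by simp [StrictPseudofunctor.map_comp]) : _ ⟶
      adj.U.map ((adj.counitApp (adj.F.obj (adj.U.obj Y)) ≫ adj.counitApp Y) ≫ g))]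
  simpa using this

/-- The induced 2-functor `U F`, with unit `η` and multiplication `U ε F`. -/
def monadData : PseudomonadData A where
  S := adj.F.comp adj.U
  unit := adj.unit
  mult :=
    { app := fun X => adj.U.map (adj.counitApp (adj.F.obj X))
      naturality := fun f => adj.mNat f
      naturality_naturality := fun γ => adj.mNat_naturality γ
      naturality_id := fun X => adj.mNat_id X
      naturality_comp := fun f g => adj.mNat_comp f g }

def lam (X : A) : 𝟙 (adj.U.obj (adj.F.obj X)) ≅
    adj.unitApp (adj.U.obj (adj.F.obj X)) ≫ adj.U.map (adj.counitApp (adj.F.obj X)) :=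
  adj.l (adj.F.obj X)

def rho (X : A) : adj.U.map (adj.F.map (adj.unitApp X)) ≫ adj.U.map (adj.counitApp (adj.F.obj X)) ≅
    𝟙 (adj.U.obj (adj.F.obj X)) :=
  (adj.U.mapComp _ _).symm ≪≫ adj.U.map₂Iso (adj.u X).symm ≪≫ adj.U.mapId _

def alpha (X : A) :
    adj.U.map (adj.F.map (adj.U.map (adj.counitApp (adj.F.obj X)))) ≫
        adj.U.map (adj.counitApp (adj.F.obj X)) ≅
      adj.U.map (adj.counitApp (adj.F.obj (adj.U.obj (adj.F.obj X)))) ≫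
        adj.U.map (adj.counitApp (adj.F.obj X)) :=
  (adj.U.mapComp _ _).symm ≪≫ adj.U.map₂Iso (adj.counitNat (adj.counitApp (adj.F.obj X))) ≪≫
    adj.U.mapComp _ _

theorem rho_hom (X : A) : (adj.rho X).hom =
    (adj.U.mapComp _ _).inv ≫ adj.U.map₂ (adj.u X).inv ≫ (adj.U.mapId _).hom := rfl

theorem alpha_hom (X : A) : (adj.alpha X).hom = (adj.U.mapComp _ _).inv ≫
    adj.U.map₂ (adj.counitNat (adj.counitApp (adj.F.obj X))).hom ≫ (adj.U.mapComp _ _).hom := rfl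

theorem assoc_coherence (X : A) :
    (α_ _ _ _).inv ≫ (((adj.U.mapComp _ _).inv ≫ adj.U.map₂ (adj.F.mapComp _ _).inv) ≫
        adj.U.map₂ (adj.F.map₂ (adj.alpha X).hom) ≫
        adj.U.map₂ (adj.F.mapComp _ _).hom ≫ (adj.U.mapComp _ _).hom) ▷
          adj.U.map (adj.counitApp (adj.F.obj X)) ≫ (α_ _ _ _).hom ≫
        adj.U.map (adj.F.map (adj.U.map (adj.counitApp (adj.F.obj (adj.U.obj (adj.F.obj X)))))) ◁
          (adj.alpha X).hom ≫ (α_ _ _ _).inv ≫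
        (adj.alpha (adj.U.obj (adj.F.obj X))).hom ▷ adj.U.map (adj.counitApp (adj.F.obj X)) ≫
        (α_ _ _ _).hom =
      adj.U.map (adj.F.map (adj.U.map (adj.F.map (adj.U.map (adj.counitApp (adj.F.obj X)))))) ◁
          (adj.alpha X).hom ≫
        (α_ _ _ _).inv ≫ (adj.mNat (adj.U.map (adj.counitApp (adj.F.obj X)))).hom ▷
          adj.U.map (adj.counitApp (adj.F.obj X)) ≫
        (α_ _ _ _).hom ≫
        adj.U.map (adj.counitApp (adj.F.obj (adj.U.obj (adj.F.obj (adj.U.obj (adj.F.obj X)))))) ◁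
          (adj.alpha X).hom := by
  rw [← cancel_mono (α_ _ _ _).inv]
  simp only [Category.assoc, Iso.hom_inv_id, Category.comp_id]
  have := adj.mult_mult (adj.counitApp (adj.F.obj X))
  simp only [Category.assoc] at this
  exact this

theorem rho_naturality {X Y : A} (f : X ⟶ Y) :
    adj.U.map (adj.F.map f) ◁ (adj.rho Y).hom ≫ (ρ_ _).hom ≫ (λ_ _).inv =
      (α_ _ _ _).inv ≫
        (((adj.U.mapComp _ _).inv ≫ adj.U.map₂ (adj.F.mapComp _ _).inv) ≫ adj.U.map₂ (adj.F.map₂ (adj.unitNat f).hom) ≫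
          (adj.U.map₂ (adj.F.mapComp _ _).hom ≫ (adj.U.mapComp _ _).hom)) ▷ adj.U.map (adj.counitApp (adj.F.obj Y)) ≫
        (α_ _ _ _).hom ≫ adj.U.map (adj.F.map (adj.unitApp X)) ◁ (adj.mNat f).hom ≫
        (α_ _ _ _).inv ≫ (adj.rho X).hom ▷ adj.U.map (adj.F.map f) := by
  have h := adj.u_naturality f
  have h2 : adj.F.map f ◁ (adj.u Y).inv ≫ (ρ_ _).hom ≫ (λ_ _).inv = (α_ _ _ _).inv ≫
      ((adj.F.mapComp _ _).inv ≫ adj.F.map₂ (adj.unitNat f).hom ≫ (adj.F.mapComp _ _).hom) ▷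
          adj.counitApp (adj.F.obj Y) ≫
        (α_ _ _ _).hom ≫ adj.F.map (adj.unitApp X) ◁ (adj.counitNat (adj.F.map f)).hom ≫
        (α_ _ _ _).inv ≫ (adj.u X).inv ▷ adj.F.map f := by
    rw [← cancel_epi (adj.F.map f ◁ (adj.u Y).hom), ← cancel_mono ((adj.u X).hom ▷ adj.F.map f),
      ← cancel_mono (α_ _ _ _).hom]
    simp only [Category.assoc, inv_hom_whiskerRight, Category.comp_id, Iso.inv_hom_id,
      whiskerLeft_hom_inv_assoc]
    exact h.symm
  have := congrArg adj.U.map₂ h2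
  rw [← cancel_epi (eqToHom (by simp [StrictPseudofunctor.map_comp]) :
    adj.U.map (adj.F.map f ≫ adj.F.map (adj.unitApp Y) ≫ adj.counitApp (adj.F.obj Y)) ⟶ _),
    ← cancel_mono (eqToHom (by simp) : _ ⟶
      adj.U.map (𝟙 _ ≫ adj.F.map f))]
  simpa [rho_hom, mNat] using this

theorem unit_coherence (X : A) :
    (λ_ _).inv ≫
        (((adj.U.mapId _).inv ≫ adj.U.map₂ (adj.F.mapId _).inv) ≫ adj.U.map₂ (adj.F.map₂ (adj.lam X).hom) ≫
          (adj.U.map₂ (adj.F.mapComp _ _).hom ≫ (adj.U.mapComp _ _).hom)) ▷ adj.U.map (adj.counitApp (adj.F.obj X)) ≫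
        (α_ _ _ _).hom ≫
        adj.U.map (adj.F.map (adj.unitApp (adj.U.obj (adj.F.obj X)))) ◁ (adj.alpha X).hom ≫
        (α_ _ _ _).inv ≫
        (adj.rho (adj.U.obj (adj.F.obj X))).hom ▷ adj.U.map (adj.counitApp (adj.F.obj X)) ≫
        (λ_ _).hom =
      𝟙 (adj.U.map (adj.counitApp (adj.F.obj X))) := by
  have h : (λ_ _).inv ≫ ((adj.F.mapId _).inv ≫ adj.F.map₂ (adj.l (adj.F.obj X)).hom ≫
        (adj.F.mapComp _ _).hom) ▷ adj.counitApp (adj.F.obj X) ≫ (α_ _ _ _).hom ≫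
        adj.F.map (adj.unitApp (adj.U.obj (adj.F.obj X))) ◁
          (adj.counitNat (adj.counitApp (adj.F.obj X))).hom ≫ (α_ _ _ _).inv ≫
        (adj.u (adj.U.obj (adj.F.obj X))).inv ▷ adj.counitApp (adj.F.obj X) ≫ (λ_ _).hom =
      𝟙 (adj.counitApp (adj.F.obj X)) := by
    have e : inv (adj.F.map₂ (adj.l (adj.F.obj X)).hom) = adj.F.map₂ (adj.l (adj.F.obj X)).inv :=
      IsIso.inv_eq_of_hom_inv_id (by simp [← PrelaxFunctor.map₂_comp])
    rw [← IsIso.inv_eq_inv]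
    simpa [e] using adj.swallowtail_counit (adj.F.obj X)
  have := congrArg adj.U.map₂ h
  rw [← cancel_epi (eqToHom (by simp) : adj.U.map (adj.counitApp (adj.F.obj X)) ⟶ _)]
  simpa [rho_hom, alpha_hom, lam] using this

/-- The pseudomonad on `A` induced by a pseudoadjunction. -/
def pseudomonad : Pseudomonad A where
  D := adj.monadData
  lam := adj.lam
  rho := adj.rho
  alpha := adj.alpha
  lam_naturality f := adj.l_naturality (adj.F.map f)
  rho_naturality f := adj.rho_naturality f
  alpha_naturality f := (adj.mult_mult (adj.F.map f)).symm
  unit_coherence X := adj.unit_coherence X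
  assoc_coherence X :=
    adj.assoc_coherence X

theorem act_id (X : A) : (adj.counitNat (adj.F.map (𝟙 X))).hom ≫
    adj.counitApp (adj.F.obj X) ◁ (adj.F.mapId X).hom =
    (adj.F.map₂ (adj.U.map₂ (adj.F.mapId X).hom ≫ (adj.U.mapId _).hom) ≫
      (adj.F.mapId _).hom) ▷ adj.counitApp (adj.F.obj X) ≫ (λ_ _).hom ≫ (ρ_ _).inv := by
  rw [adj.counitNat_congr (adj.F.map_id X), counitNat_id]
  simp

theorem act_comp {X Y Z : A} (f : X ⟶ Y) (g : Y ⟶ Z) :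
    (adj.counitNat (adj.F.map (f ≫ g))).hom ≫
      adj.counitApp (adj.F.obj X) ◁ (adj.F.mapComp f g).hom =
    (adj.F.map₂ (adj.U.map₂ (adj.F.mapComp f g).hom ≫ (adj.U.mapComp _ _).hom) ≫
      (adj.F.mapComp _ _).hom) ▷ adj.counitApp (adj.F.obj Z) ≫ (α_ _ _ _).hom ≫
      adj.F.map (adj.U.map (adj.F.map f)) ◁ (adj.counitNat (adj.F.map g)).hom ≫ (α_ _ _ _).inv ≫
      (adj.counitNat (adj.F.map f)).hom ▷ adj.F.map g ≫ (α_ _ _ _).hom := by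
  rw [adj.counitNat_congr (adj.F.map_comp f g), counitNat_comp]
  simp

theorem act_m_naturality {Y Z : B} (g : Y ⟶ Z) :
    adj.F.map (adj.U.map (adj.F.map (adj.U.map g))) ◁ (adj.counitNat (adj.counitApp Z)).inv ≫
        (α_ _ _ _).inv ≫ ((adj.F.mapComp _ _).inv ≫ adj.F.map₂ ((adj.U.mapComp _ _).inv ≫
        adj.U.map₂ (adj.counitNat g).hom ≫ (adj.U.mapComp _ _).hom) ≫
        (adj.F.mapComp _ _).hom) ▷ adj.counitApp Z ≫ (α_ _ _ _).hom ≫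
        adj.F.map (adj.U.map (adj.counitApp Y)) ◁ (adj.counitNat g).hom =
      (α_ _ _ _).inv ≫ (adj.counitNat (adj.F.map (adj.U.map g))).hom ▷ adj.counitApp Z ≫
        (α_ _ _ _).hom ≫ adj.counitApp (adj.F.obj (adj.U.obj Y)) ◁ (adj.counitNat g).hom ≫
        (α_ _ _ _).inv ≫ (adj.counitNat (adj.counitApp Y)).inv ▷ g ≫ (α_ _ _ _).hom := by
  have h := adj.counit_counit g
  rw [← cancel_epi (adj.F.map (adj.U.map (adj.F.map (adj.U.map g))) ◁
      (adj.counitNat (adj.counitApp Z)).hom), ← cancel_mono (α_ _ _ _).inv,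
    ← cancel_mono ((adj.counitNat (adj.counitApp Y)).hom ▷ g)]
  simp only [Category.assoc, inv_hom_whiskerRight, Category.comp_id, Iso.hom_inv_id_assoc,
      whiskerLeft_hom_inv_assoc]
  exact h

theorem act_assoc (X : A) :
    (α_ _ _ _).inv ≫ (adj.counitNat (adj.counitApp (adj.F.obj (adj.U.obj (adj.F.obj X))))).inv ▷
          adj.counitApp (adj.F.obj X) ≫ (α_ _ _ _).hom ≫
        adj.F.map (adj.U.map (adj.counitApp (adj.F.obj (adj.U.obj (adj.F.obj X))))) ◁
          (adj.counitNat (adj.counitApp (adj.F.obj X))).inv ≫ (α_ _ _ _).inv ≫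
        ((adj.F.mapComp _ _).inv ≫ adj.F.map₂ (adj.alpha X).inv ≫ (adj.F.mapComp _ _).hom) ▷
          adj.counitApp (adj.F.obj X) ≫ (α_ _ _ _).hom =
      adj.counitApp (adj.F.obj (adj.U.obj (adj.F.obj (adj.U.obj (adj.F.obj X))))) ◁
          (adj.counitNat (adj.counitApp (adj.F.obj X))).inv ≫ (α_ _ _ _).inv ≫
        (adj.counitNat (adj.F.map (adj.U.map (adj.counitApp (adj.F.obj X))))).inv ▷
          adj.counitApp (adj.F.obj X) ≫ (α_ _ _ _).hom ≫
        adj.F.map (adj.U.map (adj.F.map (adj.U.map (adj.counitApp (adj.F.obj X))))) ◁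
          (adj.counitNat (adj.counitApp (adj.F.obj X))).inv := by
  have h := adj.counit_counit (adj.counitApp (adj.F.obj X))
  rw [← adj.alpha_hom] at h
  have e : inv (adj.F.map₂ (adj.alpha X).hom) = adj.F.map₂ (adj.alpha X).inv :=
    IsIso.inv_eq_of_hom_inv_id (by simp [← PrelaxFunctor.map₂_comp])
  rw [← IsIso.inv_eq_inv] at h
  rw [← cancel_epi (α_ _ _ _).hom]
  simpa [e] using h

/-- The left adjoint `F` with the action `ε F : F U F ⟶ F`, with `u` and with the inverse of the
pseudonaturality constraint of `ε` at `ε_{F X}`. -/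
def cocone : KleisliCocone adj.pseudomonad B where
  F := adj.F
  act :=
    { app := fun X => adj.counitApp (adj.F.obj X)
      naturality := fun f => adj.counitNat (adj.F.map f)
      naturality_naturality := fun γ => adj.counitNat_naturality (adj.F.map₂ γ)
      naturality_id := fun X => adj.act_id X
      naturality_comp := fun f g => adj.act_comp f g }
  u := adj.u
  m X := (adj.counitNat (adj.counitApp (adj.F.obj X))).symm
  u_naturality f := adj.u_naturality f
  m_naturality f := adj.act_m_naturality (adj.F.map f)
  unit_coherence X := adj.swallowtail_counit (adj.F.obj X)
  assoc_coherence X := adj.act_assoc X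

/-- The comparison 2-functor `K : A_S ⟶ B` of a pseudoadjunction splitting the pseudomonad `T`. -/
def comparison (T : Pseudomonad A) (h : adj.pseudomonad = T) :
    StrictPseudofunctor (GrayKleisli T) B :=
  (h ▸ adj.cocone : KleisliCocone T B).desc

end Pseudoadjunction

/-!
Given 2-functors `F : A ⟶ B`, `U : B ⟶ A` with a unit and a counit that are natural in 2-cells, and
invertible 2-cells in place of the triangle identities, the functor `f ↦ F f ≫ ε` from `A(X, U Y)`
to `B(F X, Y)` is an equivalence with pseudoinverse `g ↦ η ≫ U g`; the swallowtail identities play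
no role here (`isEquivalence_map_postcomp`). For a pseudoadjunction splitting `T` this gives an
equivalence `A(X, S Y) ⟶ B(F X, F Y)`. The Kleisli object also carries such data: the inclusion
`A ⟶ A_S`, the 2-functor `A_S ⟶ A` induced by the cocone `(S, μ, ρ⁻¹, α⁻¹)`, and the action
`S X ⟶ X`. It gives an equivalence `J : A(X, S Y) ⟶ A_S(X, Y)`, and `J` followed by the comparison
is the equivalence for the pseudoadjunction, so the comparison is locally an equivalence by
two-out-of-three.

What has to be proved is that the action is a counit on all of `A_S`. Its constraint at a 1-cell
of `A_S` is obtained by pasting the 2-cells `act f` and the inverses of the 2-cells `m X` along a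
word representing the 1-cell; pasting is strictly associative and unital, so the choice of the word
does not matter (`counitWord_heq`). Naturality with respect to 2-cells is checked on generators. At
2-cells of `A` it is naturality of `act`, at `act f` it says that `m` is a modification, at `m X` it
is the associativity axiom, and at `u X` it is the unit law comparing `act X ≫ u X` with `ρ X`. This
last law is not among the axioms of a pseudoalgebra. As in Kelly's reduction of the axioms of a
monoidal category, it follows from the other unit law and associativity: the 2-cell that should
be an identity becomes one at `S X` after whiskering with `act X` (`unit_whisker_act`), and it is
a modification (`act_unit_naturality`), so it is already an identity at `X`.
-/

/-! ### Hom-equivalences from biadjunction data -/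

/-- The local form of a biadjunction: if the triangle identities hold up to arbitrary invertible
2-cells at `X` and `Y`, then `f ↦ F f ≫ e'` is an equivalence `A(X, U Y) ≌ B(F X, Y)`. No coherence
between these 2-cells and the constraints is needed, because the pseudoinverse `g ↦ η ≫ U g` need
not be promoted to an adjoint one. -/
theorem isEquivalence_map_postcomp {A : Type u} [Bicategory.{w, v} A]
    {B : Type u'} [Bicategory.{w', v'} B] (F : Pseudofunctor A B) (U : Pseudofunctor B A)
    {X : A} {Y : B} (η : X ⟶ U.obj (F.obj X)) (η' : U.obj Y ⟶ U.obj (F.obj (U.obj Y)))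
    (e : F.obj (U.obj (F.obj X)) ⟶ F.obj X) (e' : F.obj (U.obj Y) ⟶ Y)
    (nη : ∀ f : X ⟶ U.obj Y, f ≫ η' ≅ η ≫ U.map (F.map f))
    (hη : ∀ {f g : X ⟶ U.obj Y} (γ : f ⟶ g),
      γ ▷ η' ≫ (nη g).hom = (nη f).hom ≫ η ◁ U.map₂ (F.map₂ γ))
    (nC : ∀ g : F.obj X ⟶ Y, F.map (U.map g) ≫ e' ≅ e ≫ g)
    (hC : ∀ {f g : F.obj X ⟶ Y} (γ : f ⟶ g),
      F.map₂ (U.map₂ γ) ▷ e' ≫ (nC g).hom = (nC f).hom ≫ e ◁ γ)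
    (u : 𝟙 (F.obj X) ≅ F.map η ≫ e) (l : 𝟙 (U.obj Y) ≅ η' ≫ U.map e') :
    (F.mapFunctor X (U.obj Y) ⋙ postcomp (F.obj X) e').IsEquivalence := by
  let Ψ : (F.obj X ⟶ Y) ⥤ (X ⟶ U.obj Y) := U.mapFunctor (F.obj X) Y ⋙ precomp (U.obj Y) η
  let Φ : (X ⟶ U.obj Y) ⥤ (F.obj X ⟶ Y) := F.mapFunctor X (U.obj Y) ⋙ postcomp (F.obj X) e'
  let i₁ : 𝟭 (X ⟶ U.obj Y) ≅ Φ ⋙ Ψ := NatIso.ofComponents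
    (fun f => (ρ_ f).symm ≪≫ whiskerLeftIso f l ≪≫ (α_ _ _ _).symm ≪≫
      whiskerRightIso (nη f) (U.map e') ≪≫ α_ _ _ _ ≪≫
      whiskerLeftIso η (U.mapComp (F.map f) e').symm) (by
        intro f g γ
        have h : γ ▷ η' ▷ U.map e' ≫ (nη g).hom ▷ U.map e' =
            (nη f).hom ▷ U.map e' ≫ (η ◁ U.map₂ (F.map₂ γ)) ▷ U.map e' := by
          rw [← comp_whiskerRight, hη, comp_whiskerRight]
        have h' : γ ≫ (ρ_ g).inv ≫ g ◁ l.hom ≫ (α_ _ _ _).inv =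
          (ρ_ f).inv ≫ f ◁ l.hom ≫ (α_ _ _ _).inv ≫ γ ▷ η' ▷ U.map e' := by
          rw [rightUnitor_inv_naturality_assoc, ← whisker_exchange_assoc]
          simp
        change γ ≫ (ρ_ g).inv ≫ g ◁ l.hom ≫ (α_ _ _ _).inv ≫ (nη g).hom ▷ U.map e' ≫
            (α_ _ _ _).hom ≫ η ◁ (U.mapComp (F.map g) e').inv =
          ((ρ_ f).inv ≫ f ◁ l.hom ≫ (α_ _ _ _).inv ≫ (nη f).hom ▷ U.map e' ≫
            (α_ _ _ _).hom ≫ η ◁ (U.mapComp (F.map f) e').inv) ≫ η ◁ U.map₂ (F.map₂ γ ▷ e')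
        rw [reassoc_of% h', reassoc_of% h]
        simp [← whiskerLeft_comp])
  let i₂ : Ψ ⋙ Φ ≅ 𝟭 (F.obj X ⟶ Y) := NatIso.ofComponents
    (fun g => whiskerRightIso (F.mapComp η (U.map g)) e' ≪≫ α_ _ _ _ ≪≫
      whiskerLeftIso (F.map η) (nC g) ≪≫ (α_ _ _ _).symm ≪≫ whiskerRightIso u.symm g ≪≫ λ_ g) (by
        intro f g γ
        have h : F.map η ◁ F.map₂ (U.map₂ γ) ▷ e' ≫ F.map η ◁ (nC g).hom =
            F.map η ◁ (nC f).hom ≫ F.map η ◁ e ◁ γ := by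
          rw [← whiskerLeft_comp, hC, whiskerLeft_comp]
        change F.map₂ (η ◁ U.map₂ γ) ▷ e' ≫ (F.mapComp η (U.map g)).hom ▷ e' ≫ (α_ _ _ _).hom ≫
            F.map η ◁ (nC g).hom ≫ (α_ _ _ _).inv ≫ u.inv ▷ g ≫ (λ_ g).hom =
          ((F.mapComp η (U.map f)).hom ▷ e' ≫ (α_ _ _ _).hom ≫
            F.map η ◁ (nC f).hom ≫ (α_ _ _ _).inv ≫ u.inv ▷ f ≫ (λ_ f).hom) ≫ γ
        have h' : F.map₂ (η ◁ U.map₂ γ) ▷ e' ≫ (F.mapComp η (U.map g)).hom ▷ e' ≫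
            (α_ _ _ _).hom = (F.mapComp η (U.map f)).hom ▷ e' ≫ (α_ _ _ _).hom ≫
              F.map η ◁ F.map₂ (U.map₂ γ) ▷ e' := by
          simp [← comp_whiskerRight_assoc]
        rw [reassoc_of% h', reassoc_of% h]
        rw [associator_inv_naturality_right_assoc, whisker_exchange_assoc]
        simp)
  exact (CategoryTheory.Equivalence.mk Φ Ψ i₁ i₂).isEquivalence_functor

/-! ### The universal cocone -/

namespace GrayKleisli

variable {A : Type u} [Bicategory.{w, v} A] [Strict A] (T : Pseudomonad A)

/-- A generating 2-cell as an invertible 2-cell of the Kleisli object. -/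
def genIso {X Y : GrayKleisli T} {f g : X ⟶ Y} (x : Gen₂ T (X := X.as) (Y := Y.as) f g) :
    f ≅ g where
  hom := mk₂ T (.gen x)
  inv := mk₂ T (.genInv x)
  hom_inv_id := sound T (.gen_inv x)
  inv_hom_id := sound T (.inv_gen x)

/-- The canonical 2-functor `A ⟶ A_S`. -/
def inclusion : StrictPseudofunctor A (GrayKleisli T) :=
  StrictPseudofunctor.mk''
    { obj := fun X => ⟨X⟩
      map := fun f => Cell.of f
      map₂ := fun γ => mk₂ T (.of γ)
      map₂_id := fun f => sound T (.of_id f)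
      map₂_comp := fun γ δ => sound T (.of_comp γ δ)
      map_id := fun X => Cell.of_id X
      map_comp := fun f g => Cell.of_comp f g
      map₂_whisker_left := fun f g h γ => by
        have := sound T (X := ⟨_⟩) (Y := ⟨_⟩) (.of_whiskerLeft f γ)
        simp only [Term.ofComp, Term.ofCompInv, mk₂_vcomp, mk₂_eqTo] at this
        exact this
      map₂_whisker_right := fun γ h => by
        have := sound T (X := ⟨_⟩) (Y := ⟨_⟩) (.of_whiskerRight γ h)
        simp only [Term.ofComp, Term.ofCompInv, mk₂_vcomp, mk₂_eqTo] at this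
        exact this }

section

variable {W X Y Z : GrayKleisli T}

theorem mk₂_whiskerLeft (f : X ⟶ Y) {g h : Y ⟶ Z} (t : Term T (X := Y.as) (Y := Z.as) g h) :
    mk₂ T (Term.whiskerLeft (X := X.as) f t) = f ◁ mk₂ T t := rfl

theorem mk₂_whiskerRight {f g : X ⟶ Y} (t : Term T (X := X.as) (Y := Y.as) f g) (h : Y ⟶ Z) :
    mk₂ T (Term.whiskerRight (Z := Z.as) t h) = mk₂ T t ▷ h := rfl

theorem mk₂_asc (f : W ⟶ X) (g : X ⟶ Y) (h : Y ⟶ Z) :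
    mk₂ T (Term.asc (X := W.as) (Y := X.as) (Z := Y.as) (W := Z.as) f g h) = (α_ f g h).hom :=
  mk₂_eqTo T _

theorem mk₂_ascInv (f : W ⟶ X) (g : X ⟶ Y) (h : Y ⟶ Z) :
    mk₂ T (Term.ascInv (X := W.as) (Y := X.as) (Z := Y.as) (W := Z.as) f g h) = (α_ f g h).inv :=
  mk₂_eqTo T _

theorem mk₂_lunit (f : X ⟶ Y) : mk₂ T (Term.lunit (X := X.as) (Y := Y.as) f) = (λ_ f).hom :=
  mk₂_eqTo T _

theorem mk₂_lunitInv (f : X ⟶ Y) :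
    mk₂ T (Term.lunitInv (X := X.as) (Y := Y.as) f) = (λ_ f).inv :=
  mk₂_eqTo T _

theorem mk₂_runit (f : X ⟶ Y) : mk₂ T (Term.runit (X := X.as) (Y := Y.as) f) = (ρ_ f).hom :=
  mk₂_eqTo T _

theorem mk₂_runitInv (f : X ⟶ Y) :
    mk₂ T (Term.runitInv (X := X.as) (Y := Y.as) f) = (ρ_ f).inv :=
  mk₂_eqTo T _

end

section

variable {X Y Z : A}

theorem mk₂_ofComp (f : X ⟶ Y) (g : Y ⟶ Z) :
    mk₂ T (X := ⟨X⟩) (Y := ⟨Z⟩) (Term.ofComp f g) = ((inclusion T).mapComp f g).hom :=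
  mk₂_eqTo T _

theorem mk₂_ofCompInv (f : X ⟶ Y) (g : Y ⟶ Z) :
    mk₂ T (X := ⟨X⟩) (Y := ⟨Z⟩) (Term.ofCompInv f g) = ((inclusion T).mapComp f g).inv :=
  mk₂_eqTo T _

theorem mk₂_ofId (X : A) :
    mk₂ T (X := ⟨X⟩) (Y := ⟨X⟩) (Term.ofId T X) = ((inclusion T).mapId X).hom :=
  mk₂_eqTo T _

end

/-- The universal cocone, formed by the generators of the Kleisli object. Its axioms are the defining
relations; `erw` is needed below because a 1-cell `⟨X⟩ ⟶ ⟨Y⟩` is an element of `Cell T X Y` only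
after unfolding. -/
def cocone : KleisliCocone T (GrayKleisli T) where
  F := inclusion T
  act :=
    { app := fun X => Cell.act T X
      naturality := fun f => genIso T (X := ⟨_⟩) (Y := ⟨_⟩) (.act f)
      naturality_naturality := fun γ => sound T (X := ⟨_⟩) (Y := ⟨_⟩) (.act_naturality γ)
      naturality_id := fun X => by
        have := sound T (X := ⟨_⟩) (Y := ⟨_⟩) (.act_id X)
        simp only [mk₂_vcomp] at this
        erw [mk₂_whiskerLeft, mk₂_whiskerRight, mk₂_ofId, mk₂_vcomp, mk₂_ofId, mk₂_lunit,
          mk₂_runitInv] at this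
        exact this
      naturality_comp := fun f g => by
        have := sound T (X := ⟨_⟩) (Y := ⟨_⟩) (.act_comp f g)
        simp only [mk₂_vcomp] at this
        erw [mk₂_whiskerLeft, mk₂_whiskerRight, mk₂_ofComp, mk₂_vcomp, mk₂_ofComp, mk₂_asc,
          mk₂_ascInv, mk₂_asc] at this
        exact this }
  u X := genIso T (X := ⟨_⟩) (Y := ⟨_⟩) (.u X)
  m X := genIso T (X := ⟨_⟩) (Y := ⟨_⟩) (.m X)
  u_naturality f := by
    have := sound T (X := ⟨_⟩) (Y := ⟨_⟩) (.u_naturality f)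
    simp only [mk₂_vcomp] at this
    erw [mk₂_whiskerRight, mk₂_vcomp, mk₂_vcomp, mk₂_ofCompInv, mk₂_ofComp, mk₂_ascInv,
      mk₂_asc, mk₂_runit, mk₂_lunitInv, mk₂_asc] at this
    exact this
  m_naturality f := by
    have := sound T (X := ⟨_⟩) (Y := ⟨_⟩) (.m_naturality f)
    simp only [mk₂_vcomp] at this
    erw [mk₂_ascInv, mk₂_whiskerRight, mk₂_vcomp, mk₂_vcomp, mk₂_ofCompInv, mk₂_ofComp, mk₂_asc,
      mk₂_ascInv, mk₂_asc, mk₂_ascInv, mk₂_asc] at this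
    exact this
  unit_coherence X := by
    have := sound T (X := ⟨_⟩) (Y := ⟨_⟩) (.unit_coherence X)
    simp only [mk₂_vcomp] at this
    erw [mk₂_lunitInv, mk₂_asc, mk₂_ascInv, mk₂_whiskerRight, mk₂_whiskerRight, mk₂_vcomp,
      mk₂_vcomp, mk₂_ofCompInv, mk₂_ofId, mk₂_lunit] at this
    exact this
  assoc_coherence X := by
    have := sound T (X := ⟨_⟩) (Y := ⟨_⟩) (.assoc_coherence X)
    simp only [mk₂_vcomp] at this
    erw [mk₂_ascInv, mk₂_asc, mk₂_ascInv, mk₂_whiskerRight, mk₂_whiskerRight, mk₂_vcomp, mk₂_vcomp,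
      mk₂_ofCompInv, mk₂_ofComp, mk₂_asc, mk₂_ascInv, mk₂_asc] at this
    exact this

end GrayKleisli

/-! ### The free cocone -/

namespace Pseudomonad

variable {A : Type u} [Bicategory.{w, v} A] [Strict A] (T : Pseudomonad A)

/-- The 2-functor `S` with action `μ`, that is, the free pseudoalgebra structure on the identity.
The middle unit axiom and the associativity axiom of the pseudomonad, inverted, are exactly the two
pseudoalgebra axioms. -/
def freeCocone : KleisliCocone T A where
  F := T.S
  act := T.mult
  u X := (T.rho X).symm
  m X := (T.alpha X).symm
  u_naturality {X Y} f := by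
    change T.S.map f ◁ (T.rho Y).inv ≫ (α_ _ _ _).inv ≫
        ((T.S.mapComp _ _).inv ≫ T.S.map₂ (T.unitNat f).hom ≫ (T.S.mapComp _ _).hom) ▷
          T.multApp Y ≫ (α_ _ _ _).hom ≫ T.S.map (T.unitApp X) ◁ (T.multNat f).hom =
      (ρ_ _).hom ≫ (λ_ _).inv ≫ (T.rho X).inv ▷ T.S.map f ≫ (α_ _ _ _).hom
    rw [← cancel_epi (T.S.map f ◁ (T.rho Y).hom), whiskerLeft_hom_inv_assoc]
    have := T.rho_naturality f =≫ ((T.rho X).inv ▷ T.S.map f ≫ (α_ _ _ _).hom)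
    simp only [Category.assoc, hom_inv_whiskerRight_assoc, Iso.inv_hom_id,
      Category.comp_id] at this ⊢
    exact this.symm
  m_naturality {X Y} f := by
    change T.S.map (T.S.map (T.S.map f)) ◁ (T.alpha Y).inv ≫ (α_ _ _ _).inv ≫
        ((T.S.mapComp _ _).inv ≫ T.S.map₂ (T.multNat f).hom ≫ (T.S.mapComp _ _).hom) ▷
          T.multApp Y ≫ (α_ _ _ _).hom ≫ T.S.map (T.multApp X) ◁ (T.multNat f).hom =
      (α_ _ _ _).inv ≫ (T.multNat (T.S.map f)).hom ▷ T.multApp Y ≫ (α_ _ _ _).hom ≫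
        T.multApp (T.S.obj X) ◁ (T.multNat f).hom ≫ (α_ _ _ _).inv ≫
        (T.alpha X).inv ▷ T.S.map f ≫ (α_ _ _ _).hom
    rw [← cancel_epi (T.S.map (T.S.map (T.S.map f)) ◁ (T.alpha Y).hom), whiskerLeft_hom_inv_assoc]
    have := T.alpha_naturality f =≫ ((T.alpha X).inv ▷ T.S.map f ≫ (α_ _ _ _).hom)
    simp only [Category.assoc, hom_inv_whiskerRight_assoc, Iso.inv_hom_id,
      Category.comp_id] at this ⊢
    exact this.symm
  unit_coherence X := by
    change (λ_ _).inv ≫ (T.rho (T.S.obj X)).inv ▷ T.multApp X ≫ (α_ _ _ _).hom ≫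
        T.S.map (T.unitApp (T.S.obj X)) ◁ (T.alpha X).inv ≫ (α_ _ _ _).inv ≫
        ((T.S.mapComp _ _).inv ≫ T.S.map₂ (T.lam X).inv ≫ (T.S.mapId _).hom) ▷ T.multApp X ≫
        (λ_ _).hom = 𝟙 (T.multApp X)
    have e : inv (T.S.map₂ (T.lam X).hom) = T.S.map₂ (T.lam X).inv :=
      IsIso.inv_eq_of_hom_inv_id (by simp [← PrelaxFunctor.map₂_comp])
    have := T.unit_coherence X
    rw [← IsIso.inv_eq_inv] at this
    simpa [e] using this
  assoc_coherence X := by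
    change (α_ _ _ _).inv ≫ (T.alpha (T.S.obj X)).inv ▷ T.multApp X ≫ (α_ _ _ _).hom ≫
        T.S.map (T.multApp (T.S.obj X)) ◁ (T.alpha X).inv ≫ (α_ _ _ _).inv ≫
        ((T.S.mapComp _ _).inv ≫ T.S.map₂ (T.alpha X).inv ≫ (T.S.mapComp _ _).hom) ▷ T.multApp X ≫
        (α_ _ _ _).hom =
      T.multApp (T.S.obj (T.S.obj X)) ◁ (T.alpha X).inv ≫ (α_ _ _ _).inv ≫
        (T.multNat (T.multApp X)).inv ▷ T.multApp X ≫ (α_ _ _ _).hom ≫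
        T.S.map (T.S.map (T.multApp X)) ◁ (T.alpha X).inv
    have e : inv (T.S.map₂ (T.alpha X).hom) = T.S.map₂ (T.alpha X).inv :=
      IsIso.inv_eq_of_hom_inv_id (by simp [← PrelaxFunctor.map₂_comp])
    have := T.assoc_coherence X
    rw [← IsIso.inv_eq_inv] at this
    simpa [e] using this

end Pseudomonad

/-! ### Two pasting lemmas in a bicategory -/

/-- The unit law between `e₁ = act (S X)`, `u (S X)` and `rho (S X)`, after whiskering with
`e = act X`. Here `n`, `n'`, `μ`, `μ₁`, `μ'` stand for the images of `η (S X)`, `S (η (S X))`,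
`μ X`, `μ (S X)` and `S (μ X)`. It is the analogue of the triangle for `M ⊗ A ⊗ 1 ⊗ B` obtained from
the pentagon and the middle triangles. -/
theorem unit_whisker_act {C : Type u} [Bicategory.{w, v} C] {a b b₂ b₃ : C}
    {e : a ⟶ b} {e₁ : b₂ ⟶ a} {e₂ : b₃ ⟶ b₂} {n : a ⟶ b₂} {n' : b₂ ⟶ b₃} {μ : b₂ ⟶ a}
    {μ₁ μ' : b₃ ⟶ b₂} (m : e₁ ≫ e ≅ μ ≫ e) (m₁ : e₂ ≫ e₁ ≅ μ₁ ≫ e₁) (tn : n' ≫ e₂ ≅ e₁ ≫ n)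
    (tμ : μ' ≫ e₁ ≅ e₂ ≫ μ) (al : μ' ≫ μ ≅ μ₁ ≫ μ) (r : n' ≫ μ₁ ⟶ 𝟙 b₂) (l : n' ≫ μ' ⟶ 𝟙 b₂)
    (l' : n ≫ μ ⟶ 𝟙 a) (u : 𝟙 a ⟶ n ≫ e₁)
    (assoc : (α_ _ _ _).inv ≫ m₁.hom ▷ e ≫ (α_ _ _ _).hom ≫ μ₁ ◁ m.hom ≫ (α_ _ _ _).inv ≫
        al.inv ▷ e ≫ (α_ _ _ _).hom = e₂ ◁ m.hom ≫ (α_ _ _ _).inv ≫ tμ.inv ▷ e ≫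
        (α_ _ _ _).hom ≫ μ' ◁ m.hom)
    (unit : n' ◁ al.hom ≫ (α_ _ _ _).inv ≫ r ▷ μ = (α_ _ _ _).inv ≫ l ▷ μ)
    (nat : (α_ _ _ _).inv ≫ tn.inv ▷ μ ≫ (α_ _ _ _).hom ≫ n' ◁ tμ.inv ≫ (α_ _ _ _).inv ≫
        l ▷ e₁ ≫ (λ_ _).hom = e₁ ◁ l' ≫ (ρ_ _).hom)
    (unit' : (λ_ _).inv ≫ u ▷ e ≫ (α_ _ _ _).hom ≫ n ◁ m.hom ≫ (α_ _ _ _).inv ≫ l' ▷ e ≫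
        (λ_ _).hom = 𝟙 e) :
    ((ρ_ _).inv ≫ e₁ ◁ u ≫ (α_ _ _ _).inv ≫ tn.inv ▷ e₁ ≫ (α_ _ _ _).hom ≫ n' ◁ m₁.hom ≫
      (α_ _ _ _).inv ≫ r ▷ e₁ ≫ (λ_ _).hom) ▷ e = 𝟙 (e₁ ≫ e) := by
  have assoc' : m₁.hom ▷ e ≫ (α_ _ _ _).hom ≫ μ₁ ◁ m.hom = (α_ _ _ _).hom ≫
      e₂ ◁ m.hom ≫ (α_ _ _ _).inv ≫ tμ.inv ▷ e ≫ (α_ _ _ _).hom ≫ μ' ◁ m.hom ≫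
      (α_ _ _ _).inv ≫ al.hom ▷ e ≫ (α_ _ _ _).hom := by
    have := (α_ _ _ _).hom ≫= assoc =≫ ((α_ _ _ _).inv ≫ al.hom ▷ e ≫ (α_ _ _ _).hom)
    simpa using this
  -- After composition with `m`, the associativity axiom moves `m₁` past the unit.
  rw [← cancel_mono m.hom, Category.id_comp]
  calc _ = 𝟙 _ ⊗≫ e₁ ◁ u ▷ e ⊗≫ tn.inv ▷ e₁ ▷ e ⊗≫ n' ◁ m₁.hom ▷ e ⊗≫
        (r ▷ (e₁ ≫ e) ≫ 𝟙 _ ◁ m.hom) ⊗≫ 𝟙 _ := by bicategory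
    _ = 𝟙 _ ⊗≫ e₁ ◁ u ▷ e ⊗≫ tn.inv ▷ e₁ ▷ e ⊗≫
        n' ◁ (m₁.hom ▷ e ≫ (α_ _ _ _).hom ≫ μ₁ ◁ m.hom) ⊗≫ r ▷ (μ ≫ e) ⊗≫ 𝟙 _ := by
      rw [← whisker_exchange]; bicategory
    _ = 𝟙 _ ⊗≫ e₁ ◁ u ▷ e ⊗≫ (tn.inv ▷ (e₁ ≫ e) ≫ (n' ≫ e₂) ◁ m.hom) ⊗≫
        n' ◁ tμ.inv ▷ e ⊗≫ n' ◁ μ' ◁ m.hom ⊗≫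
        (n' ◁ al.hom ≫ (α_ _ _ _).inv ≫ r ▷ μ) ▷ e ⊗≫ 𝟙 _ := by
      rw [assoc']; bicategory
    _ = 𝟙 _ ⊗≫ e₁ ◁ u ▷ e ⊗≫ e₁ ◁ n ◁ m.hom ⊗≫ tn.inv ▷ μ ▷ e ⊗≫
        n' ◁ tμ.inv ▷ e ⊗≫ ((n' ≫ μ') ◁ m.hom ≫ l ▷ (μ ≫ e)) ⊗≫ 𝟙 _ := by
      rw [← whisker_exchange, unit]; bicategory
    _ = 𝟙 _ ⊗≫ e₁ ◁ u ▷ e ⊗≫ e₁ ◁ n ◁ m.hom ⊗≫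
        ((α_ _ _ _).inv ≫ tn.inv ▷ μ ≫ (α_ _ _ _).hom ≫ n' ◁ tμ.inv ≫ (α_ _ _ _).inv ≫
          l ▷ e₁ ≫ (λ_ _).hom) ▷ e ⊗≫ m.hom := by
      rw [whisker_exchange]; bicategory
    _ = e₁ ◁ ((λ_ _).inv ≫ u ▷ e ≫ (α_ _ _ _).hom ≫ n ◁ m.hom ≫ (α_ _ _ _).inv ≫ l' ▷ e ≫
        (λ_ _).hom) ⊗≫ m.hom := by
      rw [nat]; bicategory
    _ = m.hom := by rw [unit']; bicategory

/-- The endomorphisms of the action built from `u`, `m` and `rho` form a modification. The data `A`,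
`A₁`, `B`, `B'` are constraints of the action, at `f : X ⟶ Y`, at `S f` and at the units of `X` and
`Y`; `φ`, `φ₁`, `ψ` are images of the constraints of the unit and the multiplication at `f`. -/
theorem act_unit_naturality {C : Type u} [Bicategory.{w, v} C] {p q p₁ q₁ p₂ q₂ : C}
    {f : p ⟶ q} {f₁ : p₁ ⟶ q₁} {f₂ : p₂ ⟶ q₂} {e : p₁ ⟶ p} {e' : q₁ ⟶ q} {e₁ : p₂ ⟶ p₁}
    {e₁' : q₂ ⟶ q₁} {n : p ⟶ p₁} {n' : q ⟶ q₁} {n₁ : p₁ ⟶ p₂} {n₁' : q₁ ⟶ q₂} {μ : p₂ ⟶ p₁}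
    {μ' : q₂ ⟶ q₁} (A : f₁ ≫ e' ⟶ e ≫ f) (A₁ : f₂ ≫ e₁' ⟶ e₁ ≫ f₁) (B : n₁ ≫ e₁ ≅ e ≫ n)
    (B' : n₁' ≫ e₁' ≅ e' ≫ n') (φ : f ≫ n' ⟶ n ≫ f₁) (φ₁ : f₁ ≫ n₁' ⟶ n₁ ≫ f₂)
    (ψ : f₂ ≫ μ' ⟶ μ ≫ f₁) (u : 𝟙 p ⟶ n ≫ e) (u' : 𝟙 q ⟶ n' ≫ e') (m : e₁ ≫ e ⟶ μ ≫ e)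
    (m' : e₁' ≫ e' ⟶ μ' ≫ e') (r : n₁ ≫ μ ⟶ 𝟙 p₁) (r' : n₁' ≫ μ' ⟶ 𝟙 q₁)
    (hu : f ◁ u' ≫ (α_ _ _ _).inv ≫ φ ▷ e' ≫ (α_ _ _ _).hom ≫ n ◁ A =
      (ρ_ _).hom ≫ (λ_ _).inv ≫ u ▷ f ≫ (α_ _ _ _).hom)
    (hm : f₂ ◁ m' ≫ (α_ _ _ _).inv ≫ ψ ▷ e' ≫ (α_ _ _ _).hom ≫ μ ◁ A =
      (α_ _ _ _).inv ≫ A₁ ▷ e' ≫ (α_ _ _ _).hom ≫ e₁ ◁ A ≫ (α_ _ _ _).inv ≫ m ▷ f ≫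
        (α_ _ _ _).hom)
    (hr : f₁ ◁ r' ≫ (ρ_ _).hom ≫ (λ_ _).inv = (α_ _ _ _).inv ≫ φ₁ ▷ μ' ≫ (α_ _ _ _).hom ≫
      n₁ ◁ ψ ≫ (α_ _ _ _).inv ≫ r ▷ f₁)
    (hB : f₁ ◁ B'.hom ≫ (α_ _ _ _).inv ≫ A ▷ n' ≫ (α_ _ _ _).hom ≫ e ◁ φ =
      (α_ _ _ _).inv ≫ φ₁ ▷ e₁' ≫ (α_ _ _ _).hom ≫ n₁ ◁ A₁ ≫ (α_ _ _ _).inv ≫ B.hom ▷ f₁ ≫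
        (α_ _ _ _).hom) :
    f₁ ◁ ((ρ_ _).inv ≫ e' ◁ u' ≫ (α_ _ _ _).inv ≫ B'.inv ▷ e' ≫ (α_ _ _ _).hom ≫ n₁' ◁ m' ≫
        (α_ _ _ _).inv ≫ r' ▷ e' ≫ (λ_ _).hom) ≫ A =
      A ≫ ((ρ_ _).inv ≫ e ◁ u ≫ (α_ _ _ _).inv ≫ B.inv ▷ e ≫ (α_ _ _ _).hom ≫ n₁ ◁ m ≫
        (α_ _ _ _).inv ≫ r ▷ e ≫ (λ_ _).hom) ▷ f := by
  have hB' : f₁ ◁ B'.inv ≫ (α_ _ _ _).inv ≫ φ₁ ▷ e₁' ≫ (α_ _ _ _).hom ≫ n₁ ◁ A₁ ≫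
      (α_ _ _ _).inv = (α_ _ _ _).inv ≫ A ▷ n' ≫ (α_ _ _ _).hom ≫ e ◁ φ ≫ (α_ _ _ _).inv ≫
        B.inv ▷ f₁ := by
    have := f₁ ◁ B'.inv ≫= hB =≫ ((α_ _ _ _).inv ≫ B.inv ▷ f₁)
    simpa using this.symm
  calc _ = 𝟙 _ ⊗≫ f₁ ◁ e' ◁ u' ⊗≫ f₁ ◁ B'.inv ▷ e' ⊗≫ f₁ ◁ n₁' ◁ m' ⊗≫
        (f₁ ◁ r' ≫ (ρ_ _).hom ≫ (λ_ _).inv) ▷ e' ⊗≫ A := by bicategory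
    _ = 𝟙 _ ⊗≫ f₁ ◁ e' ◁ u' ⊗≫ f₁ ◁ B'.inv ▷ e' ⊗≫ ((f₁ ≫ n₁') ◁ m' ≫
        φ₁ ▷ (μ' ≫ e')) ⊗≫ n₁ ◁ ψ ▷ e' ⊗≫ (r ▷ (f₁ ≫ e') ≫ 𝟙 _ ◁ A) ⊗≫ 𝟙 _ := by
      rw [hr]; bicategory
    _ = 𝟙 _ ⊗≫ f₁ ◁ e' ◁ u' ⊗≫ f₁ ◁ B'.inv ▷ e' ⊗≫ φ₁ ▷ (e₁' ≫ e') ⊗≫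
        n₁ ◁ (f₂ ◁ m' ≫ (α_ _ _ _).inv ≫ ψ ▷ e' ≫ (α_ _ _ _).hom ≫ μ ◁ A) ⊗≫
        r ▷ (e ≫ f) ⊗≫ 𝟙 _ := by
      rw [whisker_exchange, ← whisker_exchange r A]; bicategory
    _ = 𝟙 _ ⊗≫ f₁ ◁ e' ◁ u' ⊗≫ (f₁ ◁ B'.inv ≫ (α_ _ _ _).inv ≫ φ₁ ▷ e₁' ≫
        (α_ _ _ _).hom ≫ n₁ ◁ A₁ ≫ (α_ _ _ _).inv) ▷ e' ⊗≫ n₁ ◁ e₁ ◁ A ⊗≫ n₁ ◁ m ▷ f ⊗≫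
        r ▷ (e ≫ f) ⊗≫ 𝟙 _ := by
      rw [hm]; bicategory
    _ = 𝟙 _ ⊗≫ ((f₁ ≫ e') ◁ u' ≫ A ▷ (n' ≫ e')) ⊗≫ e ◁ φ ▷ e' ⊗≫
        (B.inv ▷ (f₁ ≫ e') ≫ (n₁ ≫ e₁) ◁ A) ⊗≫ n₁ ◁ m ▷ f ⊗≫ r ▷ (e ≫ f) ⊗≫ 𝟙 _ := by
      rw [hB']; bicategory
    _ = A ⊗≫ e ◁ (f ◁ u' ≫ (α_ _ _ _).inv ≫ φ ▷ e' ≫ (α_ _ _ _).hom ≫ n ◁ A) ⊗≫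
        B.inv ▷ (e ≫ f) ⊗≫ n₁ ◁ m ▷ f ⊗≫ r ▷ (e ≫ f) ⊗≫ 𝟙 _ := by
      rw [whisker_exchange, ← whisker_exchange B.inv A]; bicategory
    _ = _ := by rw [hu]; bicategory

/-- Whiskering with a 1-cell `f` that has a right pseudoinverse `g` reflects identity 2-cells. -/
theorem eq_id_of_whiskerRight {C : Type u} [Bicategory.{w, v} C] {a b c : C} {e : a ⟶ b}
    {f : b ⟶ c} {g : c ⟶ b} (u : 𝟙 b ≅ f ≫ g) {E : e ⟶ e} (h : E ▷ f ▷ g = 𝟙 _) : E = 𝟙 e := by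
  have h' : E ▷ (f ≫ g) = 𝟙 _ := by simp [h]
  have : E ▷ 𝟙 b = 𝟙 _ := by
    rw [← cancel_mono (e ◁ u.hom), ← whisker_exchange, h']; simp
  rw [← cancel_epi (ρ_ e).hom, ← cancel_mono (ρ_ e).inv]
  simpa using this

/-! ### The derived unit law of a pseudoalgebra -/

namespace KleisliCocone

variable {A : Type u} [Bicategory.{w, v} A] [Strict A] {T : Pseudomonad A}
  {C : Type u'} [Bicategory.{w', v'} C] [Strict C] (c : KleisliCocone T C)

theorem actNat_naturality {X Y : A} {f g : X ⟶ Y} (γ : f ⟶ g) :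
    c.F.map₂ (T.S.map₂ γ) ▷ c.actApp Y ≫ (c.actNat g).hom =
      (c.actNat f).hom ≫ c.actApp X ◁ c.F.map₂ γ :=
  c.act.naturality_naturality γ

theorem actNat_id (X : A) : (c.actNat (𝟙 X)).hom ≫ c.actApp X ◁ (c.F.mapId X).hom =
    (c.F.map₂ (T.S.mapId X).hom ≫ (c.F.mapId _).hom) ▷ c.actApp X ≫ (λ_ _).hom ≫ (ρ_ _).inv :=
  c.act.naturality_id X

theorem actNat_comp {X Y Z : A} (f : X ⟶ Y) (g : Y ⟶ Z) :
    (c.actNat (f ≫ g)).hom ≫ c.actApp X ◁ (c.F.mapComp f g).hom =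
      (c.F.map₂ (T.S.mapComp f g).hom ≫ (c.F.mapComp _ _).hom) ▷ c.actApp Z ≫ (α_ _ _ _).hom ≫
        c.F.map (T.S.map f) ◁ (c.actNat g).hom ≫ (α_ _ _ _).inv ≫
        (c.actNat f).hom ▷ c.F.map g ≫ (α_ _ _ _).hom :=
  c.act.naturality_comp f g

/-- Naturality of the action with respect to a 2-cell filling a square. -/
theorem actNat_square {X Y Z W : A} {f : X ⟶ Y} {g : Y ⟶ Z} {h : X ⟶ W} {k : W ⟶ Z}
    (γ : f ≫ g ⟶ h ≫ k) :
    c.F.map (T.S.map f) ◁ (c.actNat g).hom ≫ (α_ _ _ _).inv ≫ (c.actNat f).hom ▷ c.F.map g ≫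
        (α_ _ _ _).hom ≫ c.actApp X ◁
          ((c.F.mapComp f g).inv ≫ c.F.map₂ γ ≫ (c.F.mapComp h k).hom) =
      (α_ _ _ _).inv ≫ ((c.F.mapComp _ _).inv ≫ c.F.map₂ ((T.S.mapComp f g).inv ≫ T.S.map₂ γ ≫
        (T.S.mapComp h k).hom) ≫ (c.F.mapComp _ _).hom) ▷ c.actApp Z ≫ (α_ _ _ _).hom ≫
        c.F.map (T.S.map h) ◁ (c.actNat k).hom ≫ (α_ _ _ _).inv ≫
        (c.actNat h).hom ▷ c.F.map k ≫ (α_ _ _ _).hom := by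
  have h₁ := c.actNat_comp f g
  have h₂ := c.actNat_comp h k
  have h₃ := c.actNat_naturality γ
  rw [← cancel_epi (α_ _ _ _).hom, ← cancel_epi ((c.F.map₂ (T.S.mapComp f g).hom ≫
    (c.F.mapComp _ _).hom) ▷ c.actApp Z)]
  calc _ = ((c.actNat (f ≫ g)).hom ≫ c.actApp X ◁ (c.F.mapComp f g).hom) ≫ c.actApp X ◁
          ((c.F.mapComp f g).inv ≫ c.F.map₂ γ ≫ (c.F.mapComp h k).hom) := by
        rw [h₁]; simp only [Category.assoc]
    _ = (c.F.map₂ (T.S.map₂ γ) ▷ c.actApp Z ≫ (c.actNat (h ≫ k)).hom) ≫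
        c.actApp X ◁ (c.F.mapComp h k).hom := by
        rw [h₃]; simp
    _ = _ := by
        rw [Category.assoc, h₂, Iso.hom_inv_id_assoc, ← comp_whiskerRight_assoc,
          ← comp_whiskerRight_assoc]
        simp [StrictPseudofunctor.mapComp_eq_eqToIso, PrelaxFunctor.map₂_eqToHom]

/-- Naturality of the action with respect to a 2-cell into an identity. -/
theorem actNat_triangle {X Y : A} {f : X ⟶ Y} {g : Y ⟶ X}
    (γ : f ≫ g ⟶ 𝟙 X) :
    (α_ _ _ _).inv ≫ (c.actNat f).inv ▷ c.F.map g ≫ (α_ _ _ _).hom ≫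
        c.F.map (T.S.map f) ◁ (c.actNat g).inv ≫ (α_ _ _ _).inv ≫ ((c.F.mapComp _ _).inv ≫
        c.F.map₂ ((T.S.mapComp f g).inv ≫ T.S.map₂ γ ≫ (T.S.mapId X).hom) ≫
          (c.F.mapId _).hom) ▷ c.actApp X ≫ (λ_ _).hom =
      c.actApp X ◁ ((c.F.mapComp f g).inv ≫ c.F.map₂ γ ≫ (c.F.mapId X).hom) ≫ (ρ_ _).hom := by
  have h₁ := c.actNat_comp f g
  have h₂ := c.actNat_id X
  have h₃ := c.actNat_naturality γ
  have h₄ : c.F.map (T.S.map f) ◁ (c.actNat g).hom ≫ (α_ _ _ _).inv ≫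
      (c.actNat f).hom ▷ c.F.map g ≫ (α_ _ _ _).hom ≫
      c.actApp X ◁ ((c.F.mapComp f g).inv ≫ c.F.map₂ γ ≫ (c.F.mapId X).hom) ≫ (ρ_ _).hom =
      (α_ _ _ _).inv ≫ ((c.F.mapComp _ _).inv ≫
        c.F.map₂ ((T.S.mapComp f g).inv ≫ T.S.map₂ γ ≫ (T.S.mapId X).hom) ≫
          (c.F.mapId _).hom) ▷ c.actApp X ≫ (λ_ _).hom := by
    rw [← cancel_epi (α_ _ _ _).hom, ← cancel_epi ((c.F.map₂ (T.S.mapComp f g).hom ≫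
      (c.F.mapComp _ _).hom) ▷ c.actApp X)]
    calc _ = ((c.actNat (f ≫ g)).hom ≫ c.actApp X ◁ (c.F.mapComp f g).hom) ≫ c.actApp X ◁
            ((c.F.mapComp f g).inv ≫ c.F.map₂ γ ≫ (c.F.mapId X).hom) ≫ (ρ_ _).hom := by
          rw [h₁]; simp only [Category.assoc]
      _ = (c.F.map₂ (T.S.map₂ γ) ▷ c.actApp X ≫ (c.actNat (𝟙 X)).hom) ≫
          c.actApp X ◁ (c.F.mapId X).hom ≫ (ρ_ _).hom := by
          rw [h₃]; simp
      _ = _ := by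
          rw [Category.assoc, reassoc_of% h₂, Iso.hom_inv_id_assoc, ← comp_whiskerRight_assoc,
            ← comp_whiskerRight_assoc]
          simp [StrictPseudofunctor.mapComp_eq_eqToIso, PrelaxFunctor.map₂_eqToHom]
  rw [← h₄]
  simp

attribute [local simp] StrictPseudofunctor.mapComp_eq_eqToIso Strict.associator_eqToIso
  Strict.leftUnitor_eqToIso Strict.rightUnitor_eqToIso PrelaxFunctor.map₂_eqToHom
  StrictlyUnitaryPseudofunctor.mapId_eq_eqToIso

/-- The image under `c.F` of the modification axiom for `rho`. -/
theorem map₂_rho_naturality {X Y : A} (f : X ⟶ Y) :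
    c.F.map (T.S.map f) ◁ ((c.F.mapComp _ _).inv ≫ c.F.map₂ (T.rho Y).hom ≫ (c.F.mapId _).hom) ≫
        (ρ_ _).hom ≫ (λ_ _).inv =
      (α_ _ _ _).inv ≫ ((c.F.mapComp _ _).inv ≫ c.F.map₂ ((T.S.mapComp _ _).inv ≫
        T.S.map₂ (T.unitNat f).hom ≫ (T.S.mapComp _ _).hom) ≫ (c.F.mapComp _ _).hom) ▷
          c.F.map (T.multApp Y) ≫ (α_ _ _ _).hom ≫ c.F.map (T.S.map (T.unitApp X)) ◁
        ((c.F.mapComp _ _).inv ≫ c.F.map₂ (T.multNat f).hom ≫ (c.F.mapComp _ _).hom) ≫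
        (α_ _ _ _).inv ≫ ((c.F.mapComp _ _).inv ≫ c.F.map₂ (T.rho X).hom ≫ (c.F.mapId _).hom) ▷
          c.F.map (T.S.map f) := by
  have := congrArg c.F.map₂ (T.rho_naturality f)
  rw [← cancel_epi (eqToHom (by simp [StrictPseudofunctor.map_comp]) :
    c.F.map (T.S.map f ≫ T.S.map (T.unitApp Y) ≫ T.multApp Y) ⟶ _),
    ← cancel_mono (eqToHom (by simp) : _ ⟶ c.F.map (𝟙 _ ≫ T.S.map f))]
  simpa using this

/-- The image under `c.F` of the unit axiom of `T`, with `lam` moved to the other side. -/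
theorem map₂_unit_coherence (X : A) :
    c.F.map (T.S.map (T.unitApp (T.S.obj X))) ◁
        ((c.F.mapComp _ _).inv ≫ c.F.map₂ (T.alpha X).hom ≫ (c.F.mapComp _ _).hom) ≫
        (α_ _ _ _).inv ≫ ((c.F.mapComp _ _).inv ≫ c.F.map₂ (T.rho (T.S.obj X)).hom ≫
          (c.F.mapId _).hom) ▷ c.F.map (T.multApp X) =
      (α_ _ _ _).inv ≫ ((c.F.mapComp _ _).inv ≫ c.F.map₂ ((T.S.mapComp _ _).inv ≫
        T.S.map₂ (T.lam X).inv ≫ (T.S.mapId _).hom) ≫ (c.F.mapId _).hom) ▷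
          c.F.map (T.multApp X) := by
  have h : T.S.map (T.unitApp (T.S.obj X)) ◁ (T.alpha X).hom ≫
        (α_ _ _ _).inv ≫ (T.rho (T.S.obj X)).hom ▷ T.multApp X =
      (α_ _ _ _).inv ≫ ((T.S.mapComp _ _).inv ≫
        T.S.map₂ (T.lam X).inv ≫ (T.S.mapId _).hom) ▷ T.multApp X := by
    rw [← cancel_epi ((λ_ _).inv ≫ ((T.S.mapId _).inv ≫ T.S.map₂ (T.lam X).hom ≫
      (T.S.mapComp _ _).hom) ▷ T.multApp X ≫ (α_ _ _ _).hom), ← cancel_mono (λ_ _).hom]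
    refine Eq.trans ?_ ((T.unit_coherence X).trans ?_)
    · simp only [Category.assoc]
    · simp [← comp_whiskerRight_assoc]
  have := congrArg c.F.map₂ h
  rw [← cancel_epi (eqToHom (by simp [StrictPseudofunctor.map_comp]) :
    c.F.map (T.S.map (T.unitApp (T.S.obj X)) ≫ T.S.map (T.multApp X) ≫ T.multApp X) ⟶ _),
    ← cancel_mono (eqToHom (by simp) : _ ⟶ c.F.map (𝟙 _ ≫ T.multApp X))]
  simpa using this

/-- The unit law of a pseudoalgebra that compares `act X ≫ u X` with `rho X`. It is a consequence of
the axiom `unit_coherence`, which concerns `u (S X)` and `lam X`, and of `assoc_coherence`. -/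
theorem act_unit (X : A) :
    (ρ_ _).inv ≫ c.actApp X ◁ (c.u X).hom ≫ (α_ _ _ _).inv ≫
        (c.actNat (T.unitApp X)).inv ▷ c.actApp X ≫ (α_ _ _ _).hom ≫
        c.F.map (T.S.map (T.unitApp X)) ◁ (c.m X).hom ≫ (α_ _ _ _).inv ≫
        ((c.F.mapComp _ _).inv ≫ c.F.map₂ (T.rho X).hom ≫ (c.F.mapId _).hom) ▷ c.actApp X ≫
        (λ_ _).hom = 𝟙 (c.actApp X) := by
  have h₁ := unit_whisker_act (c.m X) (c.m (T.S.obj X)) (c.actNat (T.unitApp (T.S.obj X)))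
    (c.actNat (T.multApp X))
    ((c.F.mapComp _ _).symm ≪≫ c.F.map₂Iso (T.alpha X) ≪≫ c.F.mapComp _ _) _ _ _
    (c.u (T.S.obj X)).hom (by simpa using c.assoc_coherence X) (c.map₂_unit_coherence X)
    (c.actNat_triangle (T.lam X).inv) (c.unit_coherence X)
  have h₂ := act_unit_naturality (c.actNat (T.unitApp X)).hom _ (c.actNat (T.unitApp X))
    (c.actNat (T.unitApp (T.S.obj X))) _ _ _ _ _ _ _ _ _ (c.u_naturality (T.unitApp X))
    (c.m_naturality (T.unitApp X)) (c.map₂_rho_naturality (T.unitApp X))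
    (c.actNat_square (T.unitNat (T.unitApp X)).hom)
  -- `act X` is conjugate to `act (S X)` along the unit of `X`, where `h₁` applies; the resulting
  -- whiskering with `η ≫ act X` can be cancelled, since that 1-cell is isomorphic to the identity.
  refine eq_id_of_whiskerRight (c.u X) ?_
  rw [← cancel_epi ((c.actNat (T.unitApp X)).hom ▷ c.actApp X), ← comp_whiskerRight]
  have h₃ := congrArg (fun t => t ▷ c.actApp X) h₂
  rw [← h₃, comp_whiskerRight, whisker_assoc, h₁]
  simp

end KleisliCocone

/-! ### The counit of the Kleisli object -/

theorem CategoryTheory.Iso.heq_of_hom_eq {C : Type u} [Category.{v} C] {X X' Y Y' : C} (hX : X = X')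
    (hY : Y = Y') {s : X ≅ Y} {s' : X' ≅ Y'}
    (h : s.hom = eqToHom hX ≫ s'.hom ≫ eqToHom hY.symm) : s ≍ s' := by
  subst hX hY
  exact heq_of_eq (Iso.ext (by simpa using h))

namespace KleisliCocone

variable {A : Type u} [Bicategory.{w, v} A] [Strict A] {T : Pseudomonad A}
  {C : Type u'} [Bicategory.{w', v'} C] [Strict C] (c : KleisliCocone T C)

attribute [local simp] StrictPseudofunctor.mapComp_eq_eqToIso Strict.associator_eqToIso
  Strict.leftUnitor_eqToIso Strict.rightUnitor_eqToIso PrelaxFunctor.map₂_eqToHom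
  StrictlyUnitaryPseudofunctor.mapId_eq_eqToIso

theorem actNat_id_heq (X : A) : c.actNat (𝟙 X) ≍ (whiskerRightIso (c.F.mapId (T.S.obj X))
    (c.actApp X) ≪≫ λ_ _ ≪≫ (ρ_ _).symm) := by
  refine Iso.heq_of_hom_eq (by rw [T.S.map_id]) (by rw [c.F.map_id]) ?_
  have := c.actNat_id X =≫ c.actApp X ◁ (c.F.mapId X).inv
  rw [Category.assoc, whiskerLeft_hom_inv, Category.comp_id] at this
  rw [this]
  simp

theorem actNat_comp_heq {X Y Z : A} (f : X ⟶ Y) (g : Y ⟶ Z) : c.actNat (f ≫ g) ≍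
    (whiskerRightIso (c.F.mapComp (T.S.map f) (T.S.map g)) (c.actApp Z) ≪≫ α_ _ _ _ ≪≫
      whiskerLeftIso (c.F.map (T.S.map f)) (c.actNat g) ≪≫ (α_ _ _ _).symm ≪≫
      whiskerRightIso (c.actNat f) (c.F.map g) ≪≫ α_ _ _ _) := by
  refine Iso.heq_of_hom_eq (by rw [T.S.map_comp]) (by rw [c.F.map_comp]) ?_
  have := c.actNat_comp f g =≫ c.actApp X ◁ (c.F.mapComp f g).inv
  rw [Category.assoc, whiskerLeft_hom_inv, Category.comp_id] at this
  rw [this]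
  simp

end KleisliCocone

namespace GrayKleisli

variable {A : Type u} [Bicategory.{w, v} A] [Strict A] (T : Pseudomonad A)

/-- The right adjoint `A_S ⟶ A` of the inclusion, which is `S` on `A` and sends `act X` to `μ X`. -/
def forget : StrictPseudofunctor (GrayKleisli T) A := T.freeCocone.desc

/-- The generator `act X` as the component at `X` of the counit of `inclusion T` and `forget T`. -/
def counitApp (X : GrayKleisli T) : (inclusion T).obj ((forget T).obj X) ⟶ X := Cell.act T X.as

/-- Invertible 2-cells of the shape of a naturality constraint of the counit. The 1-cell `f` stands
for `(forget T).map g`, but is kept independent of `g`, so that pasting needs no transport along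
equalities of 1-cells. -/
abbrev Square {X Y : GrayKleisli T} (f : (forget T).obj X ⟶ (forget T).obj Y) (g : X ⟶ Y) :=
  (inclusion T).map f ≫ counitApp T Y ≅ counitApp T X ≫ g

variable {T}

/-- The identity square. -/
def Square.id (X : GrayKleisli T) : Square T (𝟙 _) (𝟙 X) :=
  whiskerRightIso ((inclusion T).mapId _) _ ≪≫ λ_ _ ≪≫ (ρ_ _).symm

/-- Horizontal pasting of squares. -/
def Square.comp {X Y Z : GrayKleisli T} {f : (forget T).obj X ⟶ (forget T).obj Y}
    {f' : (forget T).obj Y ⟶ (forget T).obj Z} {g : X ⟶ Y} {g' : Y ⟶ Z}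
    (s : Square T f g) (t : Square T f' g') : Square T (f ≫ f') (g ≫ g') :=
  whiskerRightIso ((inclusion T).mapComp f f') _ ≪≫ α_ _ _ _ ≪≫ whiskerLeftIso _ t ≪≫
    (α_ _ _ _).symm ≪≫ whiskerRightIso s g' ≪≫ α_ _ _ _

theorem Square.comp_heq {X Y Z : GrayKleisli T} {f₁ f₂ : (forget T).obj X ⟶ (forget T).obj Y}
    {f₁' f₂' : (forget T).obj Y ⟶ (forget T).obj Z} {g₁ g₂ : X ⟶ Y} {g₁' g₂' : Y ⟶ Z}
    {s₁ : Square T f₁ g₁} {t₁ : Square T f₁' g₁'} {s₂ : Square T f₂ g₂} {t₂ : Square T f₂' g₂'}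
    (hf : f₁ = f₂) (hf' : f₁' = f₂') (hg : g₁ = g₂) (hg' : g₁' = g₂') (hs : s₁ ≍ s₂)
    (ht : t₁ ≍ t₂) : s₁.comp t₁ ≍ s₂.comp t₂ := by
  subst hf hf' hg hg'
  rw [eq_of_heq hs, eq_of_heq ht]

theorem Square.hom_eq {X Y : GrayKleisli T} {f f' : (forget T).obj X ⟶ (forget T).obj Y}
    {g : X ⟶ Y} {s : Square T f g} {s' : Square T f' g} (h : f = f') (hs : s ≍ s') :
    s.hom = (inclusion T).map₂ (eqToHom h) ▷ counitApp T Y ≫ s'.hom := by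
  subst h
  simp [eq_of_heq hs]

attribute [local simp] StrictPseudofunctor.mapComp_eq_eqToIso Strict.associator_eqToIso
  Strict.leftUnitor_eqToIso Strict.rightUnitor_eqToIso PrelaxFunctor.map₂_eqToHom
  StrictlyUnitaryPseudofunctor.mapId_eq_eqToIso

theorem Square.id_comp {X Y : GrayKleisli T} {f : (forget T).obj X ⟶ (forget T).obj Y} {g : X ⟶ Y}
    (s : Square T f g) : (Square.id X).comp s ≍ s := by
  refine Iso.heq_of_hom_eq (by rw [Strict.id_comp]) (by rw [Strict.id_comp]) ?_
  simp only [Square.id, Square.comp, Iso.trans_hom, whiskerLeftIso_hom]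
  rw [KleisliCocone.conj_whiskerLeft ((inclusion T).map_id _)]
  simp

theorem Square.comp_id {X Y : GrayKleisli T} {f : (forget T).obj X ⟶ (forget T).obj Y} {g : X ⟶ Y}
    (s : Square T f g) : s.comp (Square.id Y) ≍ s := by
  refine Iso.heq_of_hom_eq (by rw [Strict.comp_id]) (by rw [Strict.comp_id]) ?_
  simp [Square.id, Square.comp]

theorem Square.assoc {W X Y Z : GrayKleisli T} {f : (forget T).obj W ⟶ (forget T).obj X}
    {f' : (forget T).obj X ⟶ (forget T).obj Y} {f'' : (forget T).obj Y ⟶ (forget T).obj Z}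
    {g : W ⟶ X} {g' : X ⟶ Y} {g'' : Y ⟶ Z} (s : Square T f g) (t : Square T f' g')
    (r : Square T f'' g'') : (s.comp t).comp r ≍ s.comp (t.comp r) := by
  refine Iso.heq_of_hom_eq (by rw [Strict.assoc]) (by rw [Strict.assoc]) ?_
  simp only [Square.comp, Iso.trans_hom, whiskerLeftIso_hom]
  rw [KleisliCocone.conj_whiskerLeft ((inclusion T).map_comp f f')]
  simp

/-- The constraint of the counit along a formal composite of 1-cells. -/
def counitWord : {X Y : A} → (p : Word T X Y) →
    Square T (X := ⟨X⟩) (Y := ⟨Y⟩) (T.freeCocone.valWord p) (Quot.mk _ p)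
  | _, _, .of f => (cocone T).actNat f
  | _, _, .act X => ((cocone T).m X).symm
  | _, _, .id X => Square.id ⟨X⟩
  | _, _, .comp p q => (counitWord p).comp (counitWord q)

/-- The constraint depends only on the 1-cell represented by the word: the equations of
`Cell` match the unit and associativity laws for pasting and the pseudofunctoriality of `act`. -/
theorem counitWord_heq {X Y : A} {p q : Word T X Y} (h : WordRel T p q) :
    counitWord p ≍ counitWord q := by
  induction h with
  | comp_left p h ih =>
    exact Square.comp_heq rfl (T.freeCocone.valWord_eq h) rfl (Quot.sound h) HEq.rfl ih
  | comp_right q h ih =>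
    exact Square.comp_heq (T.freeCocone.valWord_eq h) rfl (Quot.sound h) rfl ih HEq.rfl
  | id_comp p => exact Square.id_comp _
  | comp_id p => exact Square.comp_id _
  | assoc p q r => exact Square.assoc _ _ _
  | of_id X => exact (cocone T).actNat_id_heq X
  | of_comp f g => exact (cocone T).actNat_comp_heq f g

/-- The naturality constraint of the counit. -/
def counitNat {X Y : GrayKleisli T} (f : X ⟶ Y) : Square T ((forget T).map f) f :=
  Quot.hrecOn (motive := fun f => Square T (X := X) (Y := Y) ((forget T).map f) f) f
    (fun p => counitWord p) (fun _ _ h => counitWord_heq h)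

theorem counitNat_comp {X Y Z : GrayKleisli T} (f : X ⟶ Y) (g : Y ⟶ Z) :
    (counitNat (f ≫ g)).hom = (inclusion T).map₂ ((forget T).mapComp f g).hom ▷ counitApp T Z ≫
      ((counitNat f).comp (counitNat g)).hom := by
  induction f using Quot.ind
  induction g using Quot.ind
  exact Square.hom_eq rfl HEq.rfl

variable (T) in
/-- The constraints of the counit are natural with respect to the 2-cell `t`. -/
def CounitNatural {X Y : GrayKleisli T} {f g : X ⟶ Y} (t : f ⟶ g) : Prop :=
  (inclusion T).map₂ ((forget T).map₂ t) ▷ counitApp T Y ≫ (counitNat g).hom =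
    (counitNat f).hom ≫ counitApp T X ◁ t

theorem CounitNatural.id {X Y : GrayKleisli T} (f : X ⟶ Y) : CounitNatural T (𝟙 f) := by
  simp [CounitNatural]

theorem CounitNatural.comp {X Y : GrayKleisli T} {f g h : X ⟶ Y} {s : f ⟶ g} {t : g ⟶ h}
    (hs : CounitNatural T s) (ht : CounitNatural T t) : CounitNatural T (s ≫ t) := by
  unfold CounitNatural at *
  simp [ht, reassoc_of% hs]

theorem CounitNatural.inv {X Y : GrayKleisli T} {f g : X ⟶ Y} {s : f ≅ g}
    (hs : CounitNatural T s.hom) : CounitNatural T s.inv := by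
  unfold CounitNatural at *
  rw [← cancel_epi ((inclusion T).map₂ ((forget T).map₂ s.hom) ▷ counitApp T Y),
    reassoc_of% hs]
  simp [← comp_whiskerRight_assoc, ← PrelaxFunctor.map₂_comp]

theorem CounitNatural.of {X Y : A} {f g : X ⟶ Y} (γ : f ⟶ g) :
    CounitNatural T (X := ⟨X⟩) (Y := ⟨Y⟩) ((inclusion T).map₂ γ) :=
  (cocone T).actNat_naturality γ

end GrayKleisli

/-! ### Naturality of the counit and the comparison -/

namespace KleisliCocone

variable {A : Type u} [Bicategory.{w, v} A] [Strict A] {T : Pseudomonad A}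
  {C : Type u'} [Bicategory.{w', v'} C] [Strict C] (c : KleisliCocone T C)

/-- The modification axiom for `m`, as naturality of the counit with respect to `act f`. -/
theorem act_naturality_act {X Y : A} (f : X ⟶ Y) :
    c.F.map₂ (T.multNat f).hom ▷ c.actApp Y ≫ (c.F.mapComp (T.multApp X) (T.S.map f)).hom ▷
        c.actApp Y ≫ (α_ _ _ _).hom ≫ c.F.map (T.multApp X) ◁ (c.actNat f).hom ≫
        (α_ _ _ _).inv ≫ (c.m X).inv ▷ c.F.map f ≫ (α_ _ _ _).hom =
      ((c.F.mapComp (T.S.map (T.S.map f)) (T.multApp Y)).hom ▷ c.actApp Y ≫ (α_ _ _ _).hom ≫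
        c.F.map (T.S.map (T.S.map f)) ◁ (c.m Y).inv ≫ (α_ _ _ _).inv ≫
        (c.actNat (T.S.map f)).hom ▷ c.actApp Y ≫ (α_ _ _ _).hom) ≫
        c.actApp (T.S.obj X) ◁ (c.actNat f).hom := by
  have := ((c.F.mapComp (T.S.map (T.S.map f)) (T.multApp Y)).hom ▷ c.actApp Y ≫
    (α_ _ _ _).hom ≫ c.F.map (T.S.map (T.S.map f)) ◁ (c.m Y).inv) ≫= c.m_naturality f =≫
      ((α_ _ _ _).inv ≫ (c.m X).inv ▷ c.F.map f ≫ (α_ _ _ _).hom)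
  simpa using this

/-- The unit law `act_unit`, as naturality of the counit with respect to `u X`. -/
theorem act_naturality_u (X : A) :
    c.F.map₂ (T.rho X).inv ▷ c.actApp X ≫ (c.F.mapComp (T.S.map (T.unitApp X)) (T.multApp X)).hom ▷
        c.actApp X ≫ (α_ _ _ _).hom ≫ c.F.map (T.S.map (T.unitApp X)) ◁ (c.m X).inv ≫
        (α_ _ _ _).inv ≫ (c.actNat (T.unitApp X)).hom ▷ c.actApp X ≫ (α_ _ _ _).hom =
      ((c.F.mapId (T.S.obj X)).hom ▷ c.actApp X ≫ (λ_ _).hom ≫ (ρ_ _).inv) ≫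
        c.actApp X ◁ (c.u X).hom := by
  have h {f : c.F.obj (T.S.obj X) ⟶ c.F.obj X} (t : c.F.map _ ≫ c.actApp X ⟶ f) :
      c.F.map₂ (T.rho X).hom ▷ c.actApp X ≫ c.F.map₂ (T.rho X).inv ▷ c.actApp X ≫ t = t :=
    hom_inv_whiskerRight_assoc (c.F.map₂Iso (T.rho X)) (c.actApp X) t
  have := ((c.F.mapId (T.S.obj X)).hom ▷ c.actApp X ≫ (λ_ _).hom) ≫= c.act_unit X =≫
    ((λ_ _).inv ≫ (c.F.mapId (T.S.obj X)).inv ▷ c.actApp X ≫ c.F.map₂ (T.rho X).inv ▷ c.actApp X ≫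
      (c.F.mapComp (T.S.map (T.unitApp X)) (T.multApp X)).hom ▷
        c.actApp X ≫ (α_ _ _ _).hom ≫ c.F.map (T.S.map (T.unitApp X)) ◁ (c.m X).inv ≫
        (α_ _ _ _).inv ≫ (c.actNat (T.unitApp X)).hom ▷ c.actApp X ≫ (α_ _ _ _).hom)
  simpa [h] using this.symm

/-- The associativity axiom, as naturality of the counit with respect to `m X`. -/
theorem act_naturality_m (X : A) :
    c.F.map₂ (T.alpha X).inv ▷ c.actApp X ≫
        (c.F.mapComp (T.S.map (T.multApp X)) (T.multApp X)).hom ▷ c.actApp X ≫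
        (α_ _ _ _).hom ≫ c.F.map (T.S.map (T.multApp X)) ◁ (c.m X).inv ≫
        (α_ _ _ _).inv ≫ (c.actNat (T.multApp X)).hom ▷ c.actApp X ≫ (α_ _ _ _).hom =
      ((c.F.mapComp (T.multApp (T.S.obj X)) (T.multApp X)).hom ▷ c.actApp X ≫ (α_ _ _ _).hom ≫
        c.F.map (T.multApp (T.S.obj X)) ◁ (c.m X).inv ≫
        (α_ _ _ _).inv ≫ (c.m (T.S.obj X)).inv ▷ c.actApp X ≫ (α_ _ _ _).hom) ≫
        c.actApp (T.S.obj (T.S.obj X)) ◁ (c.m X).hom := by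
  have := ((c.F.mapComp (T.multApp (T.S.obj X)) (T.multApp X)).hom ▷ c.actApp X ≫ (α_ _ _ _).hom ≫
        c.F.map (T.multApp (T.S.obj X)) ◁ (c.m X).inv ≫
        (α_ _ _ _).inv ≫ (c.m (T.S.obj X)).inv ▷ c.actApp X ≫ (α_ _ _ _).hom) ≫=
      c.assoc_coherence X =≫ (c.F.map (T.S.map (T.multApp X)) ◁ (c.m X).inv ≫
        (α_ _ _ _).inv ≫ (c.actNat (T.multApp X)).hom ▷ c.actApp X ≫ (α_ _ _ _).hom)
  simpa using this

end KleisliCocone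

namespace GrayKleisli

variable {A : Type u} [Bicategory.{w, v} A] [Strict A] {T : Pseudomonad A}

theorem CounitNatural.whiskerLeft {X Y Z : GrayKleisli T} (f : X ⟶ Y) {g h : Y ⟶ Z} {t : g ⟶ h}
    (ht : CounitNatural T t) : CounitNatural T (f ◁ t) := by
  unfold CounitNatural at *
  have h₁ : (forget T).map₂ (f ◁ t) ≫ ((forget T).mapComp f h).hom =
      ((forget T).mapComp f g).hom ≫ (forget T).map f ◁ (forget T).map₂ t := by simp
  have h₂ : (inclusion T).map₂ ((forget T).map f ◁ (forget T).map₂ t) ▷ counitApp T Z ≫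
      ((inclusion T).mapComp _ _).hom ▷ counitApp T Z ≫ (α_ _ _ _).hom =
      ((inclusion T).mapComp _ _).hom ▷ counitApp T Z ≫ (α_ _ _ _).hom ≫
        (inclusion T).map ((forget T).map f) ◁ (inclusion T).map₂ ((forget T).map₂ t) ▷
          counitApp T Z := by
    simp
  have h₃ := congrArg (fun s => (inclusion T).map ((forget T).map f) ◁ s) ht
  simp only [Bicategory.whiskerLeft_comp] at h₃
  rw [counitNat_comp, ← comp_whiskerRight_assoc, ← PrelaxFunctor.map₂_comp, h₁,
    PrelaxFunctor.map₂_comp, comp_whiskerRight_assoc, counitNat_comp]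
  simp only [Square.comp, Iso.trans_hom, whiskerLeftIso_hom, whiskerRightIso_hom, Iso.symm_hom,
    Category.assoc]
  rw [reassoc_of% h₂, reassoc_of% h₃, associator_inv_naturality_right_assoc,
    whisker_exchange_assoc]
  simp

theorem CounitNatural.whiskerRight {X Y Z : GrayKleisli T} {f g : X ⟶ Y} {t : f ⟶ g}
    (ht : CounitNatural T t) (h : Y ⟶ Z) : CounitNatural T (t ▷ h) := by
  unfold CounitNatural at *
  have h₁ : (forget T).map₂ (t ▷ h) ≫ ((forget T).mapComp g h).hom =
      ((forget T).mapComp f h).hom ≫ (forget T).map₂ t ▷ (forget T).map h := by simp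
  have h₂ : (inclusion T).map₂ ((forget T).map₂ t ▷ (forget T).map h) ▷ counitApp T Z ≫
      ((inclusion T).mapComp _ _).hom ▷ counitApp T Z ≫ (α_ _ _ _).hom =
      ((inclusion T).mapComp _ _).hom ▷ counitApp T Z ≫ (α_ _ _ _).hom ≫
        (inclusion T).map₂ ((forget T).map₂ t) ▷ ((inclusion T).map ((forget T).map h) ≫
          counitApp T Z) := by
    simp
  have h₃ := congrArg (fun s => s ▷ h) ht
  simp only [comp_whiskerRight] at h₃
  rw [counitNat_comp, ← comp_whiskerRight_assoc, ← PrelaxFunctor.map₂_comp, h₁,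
    PrelaxFunctor.map₂_comp, comp_whiskerRight_assoc, counitNat_comp]
  simp only [Square.comp, Iso.trans_hom, whiskerLeftIso_hom, whiskerRightIso_hom, Iso.symm_hom,
    Category.assoc]
  rw [reassoc_of% h₂, ← whisker_exchange_assoc, associator_inv_naturality_left_assoc,
    reassoc_of% h₃]
  simp

theorem counitNatural_gen {X Y : A} {f g : Cell T X Y} (x : Gen₂ T f g) :
    CounitNatural T (genIso T (X := ⟨X⟩) (Y := ⟨Y⟩) x).hom := by
  cases x with
  | act f => exact (cocone T).act_naturality_act f
  | u => exact (cocone T).act_naturality_u _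
  | m => exact (cocone T).act_naturality_m _

theorem counitNatural_mk {X Y : A} {f g : Cell T X Y} (t : Term T f g) :
    CounitNatural T (mk₂ T (X := ⟨X⟩) (Y := ⟨Y⟩) t) := by
  induction t with
  | of γ => exact CounitNatural.of γ
  | gen x => exact counitNatural_gen x
  | genInv x => exact (counitNatural_gen x).inv
  | id f => exact CounitNatural.id _
  | vcomp s t hs ht => exact CounitNatural.comp hs ht
  | whiskerLeft f t ht => exact CounitNatural.whiskerLeft _ ht
  | whiskerRight t h ht => exact CounitNatural.whiskerRight ht _

theorem counitNat_naturality {X Y : GrayKleisli T} {f g : X ⟶ Y} (t : f ⟶ g) :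
    (inclusion T).map₂ ((forget T).map₂ t) ▷ counitApp T Y ≫ (counitNat g).hom =
      (counitNat f).hom ≫ counitApp T X ◁ t := by
  obtain ⟨t⟩ := t
  exact counitNatural_mk t

/-- Every 1-cell `X ⟶ Y` of the Kleisli object is isomorphic to one of the form `f ≫ act Y` with
`f : X ⟶ S Y` in `A`, and the 2-cells between such 1-cells are those of `A`. -/
theorem isEquivalence_inclusion_act (X Y : GrayKleisli T) :
    ((inclusion T).mapFunctor X.as (T.S.obj Y.as) ⋙
      postcomp ((inclusion T).obj X.as) (counitApp T Y)).IsEquivalence :=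
  isEquivalence_map_postcomp (inclusion T).toPseudofunctor (forget T).toPseudofunctor
    (T.unitApp X.as) (T.unitApp (T.S.obj Y.as)) (counitApp T X) (counitApp T Y)
    (fun f => T.unitNat f) (fun γ => T.unit.naturality_naturality γ) (fun g => counitNat g)
    (fun t => counitNat_naturality t) ((cocone T).u X.as) (T.lam Y.as)

end GrayKleisli

theorem mainTheorem3 {A : Type u} [Bicategory.{w, v} A] [Strict A] {B : Type u'}
    [Bicategory.{w', v'} B] [Strict B] (T : Pseudomonad A) (adj : Pseudoadjunction A B)
    (h : adj.pseudomonad = T) (X Y : GrayKleisli T) :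
    ((adj.comparison T h).mapFunctor X Y).IsEquivalence := by
  subst h
  have h₁ := GrayKleisli.isEquivalence_inclusion_act X Y
  have h₂ : (adj.F.mapFunctor X.as (adj.U.obj (adj.F.obj Y.as)) ⋙
      postcomp (adj.F.obj X.as) (adj.counitApp (adj.F.obj Y.as))).IsEquivalence :=
    isEquivalence_map_postcomp adj.F.toPseudofunctor adj.U.toPseudofunctor (adj.unitApp X.as)
      (adj.unitApp _) (adj.counitApp _) (adj.counitApp _) (fun f => adj.unitNat f)
      (fun γ => adj.unit.naturality_naturality γ) (fun g => adj.counitNat g)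
      (fun γ => adj.counitNat_naturality γ) (adj.u X.as) (adj.l (adj.F.obj Y.as))
  -- `J` followed by the comparison is `f ↦ F f ≫ ε`, already on the nose on 1-cells.
  let K := adj.comparison adj.pseudomonad rfl
  let J := (GrayKleisli.inclusion adj.pseudomonad).mapFunctor X.as (adj.pseudomonad.S.obj Y.as) ⋙
      postcomp ((GrayKleisli.inclusion adj.pseudomonad).obj X.as) (GrayKleisli.counitApp _ Y)
  have : J.IsEquivalence := h₁
  have e : J ⋙ K.mapFunctor X Y ≅ adj.F.mapFunctor X.as (adj.U.obj (adj.F.obj Y.as)) ⋙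
      postcomp (adj.F.obj X.as) (adj.counitApp (adj.F.obj Y.as)) :=
    NatIso.ofComponents (fun f => Iso.refl _) (by
      intro f g γ
      -- The two `eqToHom`s in the value of a whiskered term have reflexive proofs here, so they are
      -- identities by definition.
      have := adj.cocone.valTerm_whiskerRight (.of γ) (GrayKleisli.Cell.act adj.pseudomonad Y.as)
      exact (Category.comp_id _).trans (this.trans (congrArg (𝟙 _ ≫ ·) (Category.comp_id _))))
  have : (J ⋙ K.mapFunctor X Y).IsEquivalence := @Functor.isEquivalence_of_iso _ _ _ _ _ _ e.symm h₂
  exact Functor.isEquivalence_of_comp_left J _
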